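/- Let $\Bbbk$ be a field, let $N,k,r\ge 0$ be integers, and let $f_0,\dots,f_k\in R=\Bbbk[x_1,\dots,x_N]$ be homogeneous of degree $r$, where $\deg x_i=1$. Put $I=(f_0,\dots,f_k)$, and let $\mathcal R(I)=\bigoplus_{n\ge 0} I^n t^n\subseteq R[t]$ be the Rees algebra of $I$, regarded as a quotient of $S=\Bbbk[x_1,\dots,x_N,w_0,\dots,w_k]$ through $x_i\mapsto x_i$, $w_i\mapsto f_i t$, and bigraded by $\deg x_i=(1,0)$, $\deg w_i=(0,1)$. Write $$\beta_{i,n}(I^d)=\dim_\Bbbk \mathrm{Tor}^R_i(\Bbbk,I^d)_n,\qquad \beta_{i,(j,m)}(\mathcal R(I))=\dim_\Bbbk \mathrm{Tor}^S_i(\Bbbk,\mathcal R(I))_{(j,m)}$$ for the graded and bigraded Betti numbers. Then for all integers $i,d\ge 0$ and all $j\in\mathbb Z$, $$\beta_{i,j+rd}(I^d)\;\le\;\sum_{m=0}^{d}\binom{d+k-m}{d-m}\,\beta_{i,(j,m)}(\mathcal R(I)).$$ -/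

import Mathlib

open MvPolynomial

universe u

noncomputable section

namespace GradedBetti

/-! ### Graded Betti numbers over a polynomial ring

`S = K[x_s : s ∈ σ]` is graded by an abelian group `A` through `deg x_s = w s`, and `M` is an
`S`-module whose homogeneous elements of degree `a` are `𝓜 a`.  The graded Betti number
`β_{i,a}(M) = dim_K Tor_i^S(K, M)_a` is computed as usual: take a graded free resolution of `M`,
tensor it with `K = S / (x_s : s ∈ σ)`, and take the degree `a` part of the `i`-th homology. The
resolution used is the canonical one, in which each free module has one generator for every
nonzero homogeneous element of the module (`M`, then the successive syzygies) to be covered. -/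

variable {K : Type u} [Field K] {σ A : Type} [AddCommGroup A]

/-- A graded free `S`-module `F = ⨁_{g ∈ gens} S(-deg g)`, realised as `gens →₀ S`, with a
submodule of it, to be thought of as the kernel of the map going out of `F`. -/
structure Stage (K : Type u) [Field K] (σ A : Type) where
  /-- the index set of the homogeneous basis -/
  gens : Type u
  /-- the degrees of the basis elements -/
  deg : gens → A
  /-- the syzygies -/
  syz : Submodule (MvPolynomial σ K) (gens →₀ MvPolynomial σ K)

/-- An element `v` of `F = ⨁ S(-deg g)` is homogeneous of degree `a` when its coordinate at each
`g` is homogeneous of degree `a - deg g`. -/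
def Stage.IsHomogeneous (w : σ → A) (T : Stage K σ A) (v : T.gens →₀ MvPolynomial σ K) (a : A) :
    Prop :=
  ∀ g, IsWeightedHomogeneous w (v g) (a - T.deg g)

/-- The first free module of the resolution, with one generator of degree `a` for each nonzero
homogeneous element of `M` of degree `a`. -/
abbrev firstStage {M : Type u} [AddCommGroup M] [Module (MvPolynomial σ K) M]
    (𝓜 : A → AddSubgroup M) : Stage K σ A where
  gens := {p : A × M // p.2 ≠ 0 ∧ p.2 ∈ 𝓜 p.1}
  deg g := g.1.1
  syz := LinearMap.ker (Finsupp.linearCombination (MvPolynomial σ K)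
    fun g : {p : A × M // p.2 ≠ 0 ∧ p.2 ∈ 𝓜 p.1} => g.1.2)

/-- The generators of the next free module: one generator of degree `a` for each nonzero
homogeneous syzygy of degree `a`. -/
abbrev Stage.NextGens (w : σ → A) (T : Stage K σ A) : Type u :=
  {p : A × (T.gens →₀ MvPolynomial σ K) // p.2 ≠ 0 ∧ p.2 ∈ T.syz ∧ T.IsHomogeneous w p.2 p.1}

/-- The differential from the next free module: a generator is sent to the syzygy it names. -/
def Stage.diff (w : σ → A) (T : Stage K σ A) :
    (T.NextGens w →₀ MvPolynomial σ K) →ₗ[MvPolynomial σ K] (T.gens →₀ MvPolynomial σ K) :=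
  Finsupp.linearCombination _ fun g : T.NextGens w => g.1.2

/-- The next free module of the resolution. -/
abbrev Stage.next (w : σ → A) (T : Stage K σ A) : Stage K σ A where
  gens := T.NextGens w
  deg g := g.1.1
  syz := LinearMap.ker (T.diff w)

/-- The differential after applying `K ⊗_S -`, where `K ⊗_S F` is identified with `gens →₀ K`:
the entries of the matrix of the differential are replaced by their constant coefficients. -/
def Stage.diffBar (w : σ → A) (T : Stage K σ A) :
    (T.NextGens w →₀ K) →ₗ[K] (T.gens →₀ K) :=
  Finsupp.linearCombination K fun g : T.NextGens w =>
    Finsupp.mapRange (constantCoeff : MvPolynomial σ K →+* K) (map_zero _) g.1.2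

/-- The degree `a` part of `K ⊗_S F`. -/
def Stage.barPiece (T : Stage K σ A) (a : A) : Submodule K (T.gens →₀ K) :=
  Finsupp.supported K K {g | T.deg g = a}

section Resolution

variable (K) (w : σ → A) {M : Type u} [AddCommGroup M] [Module (MvPolynomial σ K) M]
  (𝓜 : A → AddSubgroup M)

/-- The canonical graded free resolution `⋯ → F_2 → F_1 → F_0 → M`. -/
def resolution : ℕ → Stage K σ A
  | 0 => firstStage 𝓜
  | i + 1 => (resolution i).next w

/-- The cycles of degree `a` in the complex `K ⊗_S F`, in homological degree `i`. -/
def cycles : (i : ℕ) → (a : A) → Submodule K ((resolution K w 𝓜 i).gens →₀ K)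
  | 0, a => (resolution K w 𝓜 0).barPiece a
  | i + 1, a => (resolution K w 𝓜 (i + 1)).barPiece a ⊓ LinearMap.ker ((resolution K w 𝓜 i).diffBar w)

/-- The boundaries of degree `a` in the complex `K ⊗_S F`, in homological degree `i`. -/
def boundaries (i : ℕ) (a : A) : Submodule K ((resolution K w 𝓜 i).gens →₀ K) :=
  ((resolution K w 𝓜 (i + 1)).barPiece a).map ((resolution K w 𝓜 i).diffBar w)

/-- `Tor_i^S(K, M)_a`, the degree `a` part of the homology of `K ⊗_S F`: the image of the cycles in
`(K ⊗_S F_i) / boundaries`. -/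
def torPiece (i : ℕ) (a : A) :
    Submodule K (((resolution K w 𝓜 i).gens →₀ K) ⧸ boundaries K w 𝓜 i a) :=
  (cycles K w 𝓜 i a).map (boundaries K w 𝓜 i a).mkQ

/-- The graded Betti number `β_{i,a}(M) = dim_K Tor_i^S(K, M)_a`. -/
def betti (i : ℕ) (a : A) : Cardinal.{u} :=
  Module.rank K (torPiece K w 𝓜 i a)

end Resolution

/-! ### Ideals of `R = K[x_1, …, x_N]` with the standard grading -/

/-- The homogeneous elements of degree `n` of an ideal of `R`, where `deg x_i = 1`. -/
def idealPiece {N : ℕ} (J : Ideal (MvPolynomial (Fin N) K)) (n : ℤ) : AddSubgroup J :=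
  (weightedHomogeneousSubmodule K (fun _ : Fin N => (1 : ℤ)) n).toAddSubgroup.comap
    (J.subtype : J →+ MvPolynomial (Fin N) K)

/-- `β_{i,n}(J) = dim_K Tor_i^R(K, J)_n` for a homogeneous ideal `J` of `R`. -/
def idealBetti {N : ℕ} (J : Ideal (MvPolynomial (Fin N) K)) (i : ℕ) (n : ℤ) : Cardinal.{u} :=
  betti K (fun _ : Fin N => (1 : ℤ)) (idealPiece J) i n

/-! ### The Rees algebra of `I = (f_0, …, f_k)` as a bigraded module over
`S = K[x_1, …, x_N, w_0, …, w_k]` -/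

section Rees

variable {N k : ℕ} (f : Fin (k + 1) → MvPolynomial (Fin N) K)

/-- The Rees algebra `R ⊕ It ⊕ I²t² ⊕ ⋯ ⊆ R[t]` of `I = (f_0, …, f_k)`. -/
def Rees : Type u := reesAlgebra (Ideal.span (Set.range f))

instance : CommRing (Rees f) := inferInstanceAs (CommRing (reesAlgebra (Ideal.span (Set.range f))))

instance : Algebra (MvPolynomial (Fin N) K) (Rees f) :=
  inferInstanceAs (Algebra (MvPolynomial (Fin N) K) (reesAlgebra (Ideal.span (Set.range f))))

/-- The element `f_i t` of the Rees algebra. -/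
def Rees.ft (i : Fin (k + 1)) : Rees f :=
  ⟨Polynomial.monomial 1 (f i), reesAlgebra.monomial_mem.2
    (by rw [pow_one]; exact Ideal.subset_span ⟨i, rfl⟩)⟩

/-- The presentation `S → R(I)`, `x_i ↦ x_i`, `w_i ↦ f_i t`. -/
def Rees.presentation : MvPolynomial (Fin N ⊕ Fin (k + 1)) K →+* Rees f :=
  eval₂Hom ((algebraMap (MvPolynomial (Fin N) K) (Rees f)).comp C)
    (Sum.elim (fun i => algebraMap (MvPolynomial (Fin N) K) (Rees f) (X i)) (Rees.ft f))

/-- The Rees algebra is an `S`-module through its presentation. -/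
instance : Module (MvPolynomial (Fin N ⊕ Fin (k + 1)) K) (Rees f) :=
  Module.compHom (Rees f) (Rees.presentation f)

/-- The bigrading of `S`: `deg x_i = (1, 0)` and `deg w_i = (0, 1)`. -/
def bideg (N k : ℕ) : Fin N ⊕ Fin (k + 1) → ℤ × ℤ :=
  Sum.elim (fun _ => (1, 0)) (fun _ => (0, 1))

/-- The bigrading of the Rees algebra as a quotient of `S`: the elements of bidegree `a` are the
images of the polynomials of bidegree `a`. -/
def reesPiece (a : ℤ × ℤ) : AddSubgroup (Rees f) :=
  (weightedHomogeneousSubmodule K (bideg N k) a).toAddSubgroup.map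
    (Rees.presentation f : MvPolynomial (Fin N ⊕ Fin (k + 1)) K →+ Rees f)

/-- `β_{i,a}(R(I)) = dim_K Tor_i^S(K, R(I))_a`. -/
def reesBetti (i : ℕ) (a : ℤ × ℤ) : Cardinal.{u} :=
  betti K (bideg N k) (reesPiece f) i a

end Rees

end GradedBetti

end

/-! Let F be a bigraded free resolution of the Rees algebra over S. In w-degree d the Rees algebra
is I^d t^d, with bidegree (j, d) matching degree j + rd of I^d. As S is free over R, the w-degree d
strand of F is an R-free resolution of I^d, so Tor^R_i(K, I^d) in degree j + rd is H_i(F/(x)F) in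
bidegree (j, d).

Now kill w_0, …, w_k one at a time. For a variable w of degree δ that is regular on the complex E,
the long exact sequence of 0 → E(-δ) → E → E/wE → 0 gives h(d) ≤ h(d-1) + h'(d). Since h vanishes in
negative w-degree, h is bounded by the partial sums of h'. After k + 1 such steps the complex is K ⊗
F, and the iterated partial sums have weights `multichoose (k + 1) (d - m)`, the binomials of the
statement.

The strand is reached through a comparison map from the canonical resolution of I^d over R to that
of the Rees algebra over S. Its mapping cone is exact in the degrees of the strand and stays exact
when the x-variables are killed (`RegularStep.exactMod`), so the comparison is injective on homology
(`StrandEquiv.resBetti_le`, applied to `strandEquiv_rees`). The long exact sequence is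
`RegularStep.bettiMod_le`; the induction over the w-variables is `resBetti_compl_le`. -/

noncomputable section

namespace GradedBetti

/-! ### Ranks of subquotients -/

section RelRank

variable {K V W : Type u} [Field K] [AddCommGroup V] [Module K V] [AddCommGroup W] [Module K W]

/-- The dimension of the image of `Z` in `V ⧸ B`. -/
def relRank (Z B : Submodule K V) : Cardinal.{u} := Module.rank K (Z.map B.mkQ)

/-- Only covering matters: `g` need not send `Z'` into `Z`. -/
theorem relRank_le_of_surjective {Z B : Submodule K V} {Z' B' : Submodule K W} (g : W →ₗ[K] V)
    (hZ : ∀ z ∈ Z, ∃ z' ∈ Z', z - g z' ∈ B) (hB : ∀ b ∈ B', g b ∈ B) :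
    relRank Z B ≤ relRank Z' B' := by
  have h : Z.map B.mkQ ≤ (Z'.map B'.mkQ).map (B'.mapQ B g hB) := by
    rintro _ ⟨z, hz, rfl⟩
    obtain ⟨z', hz', h⟩ := hZ z hz
    exact ⟨B'.mkQ z', ⟨z', hz', rfl⟩, ((Submodule.Quotient.eq B).2 h).symm⟩
  exact (Submodule.rank_mono h).trans (rank_map_le _ _)

theorem relRank_le_of_injective {Z B : Submodule K V} {Z' B' : Submodule K W} (g : V →ₗ[K] W)
    (hZ : ∀ z ∈ Z, g z ∈ Z') (hB : ∀ z ∈ Z, g z ∈ B' → z ∈ B) :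
    relRank Z B ≤ relRank Z' B' := by
  -- `g` need not send `B` into `B'`, so it is factored through the smaller `B₀`, modulo which it is
  -- injective on `Z`.
  let B₀ : Submodule K V := Z ⊓ B'.comap g
  have hB₀ : B₀ ≤ B'.comap g := inf_le_right
  refine (relRank_le_of_surjective (Z' := Z) (B' := B₀) LinearMap.id (fun z hz => ⟨z, hz, by simp⟩)
    (fun b hb => hB b hb.1 hb.2)).trans ?_
  have hmap : ∀ q ∈ Z.map B₀.mkQ, B₀.mapQ B' g hB₀ q ∈ Z'.map B'.mkQ := by
    rintro _ ⟨z, hz, rfl⟩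
    exact ⟨g z, hZ z hz, rfl⟩
  refine LinearMap.rank_le_of_injective ((B₀.mapQ B' g hB₀).restrict hmap) ?_
  rw [injective_iff_map_eq_zero]
  rintro ⟨_, z, hz, rfl⟩ h
  have h' : B'.mkQ (g z) = 0 := congrArg Subtype.val h
  refine Subtype.ext ((Submodule.Quotient.mk_eq_zero B₀).2 ⟨hz, ?_⟩)
  exact (Submodule.Quotient.mk_eq_zero B').1 h'

/-- Rank-nullity for the map from the image of `Z` modulo `B` to its image modulo `B'`; the kernel
comes from `Z ⊓ B'`. -/
theorem relRank_le_add (Z : Submodule K V) {B B' : Submodule K V} (h : B ≤ B') :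
    relRank Z B ≤ relRank (Z ⊓ B') B + relRank Z B' := by
  let g : (V ⧸ B) →ₗ[K] V ⧸ B' := B.mapQ B' LinearMap.id h
  let q := g.domRestrict (Z.map B.mkQ)
  have hr : Module.rank K (LinearMap.range q) ≤ relRank Z B' := by
    refine Submodule.rank_mono ?_
    rintro _ ⟨⟨_, z, hz, rfl⟩, rfl⟩
    exact ⟨z, hz, rfl⟩
  have hk : Module.rank K (LinearMap.ker q) ≤ relRank (Z ⊓ B') B := by
    have : (LinearMap.ker q).map (Z.map B.mkQ).subtype ≤ (Z ⊓ B').map B.mkQ := by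
      rintro _ ⟨⟨_, z, hz, rfl⟩, hx, rfl⟩
      exact ⟨z, ⟨hz, (Submodule.Quotient.mk_eq_zero B').1 hx⟩, rfl⟩
    refine le_trans ?_ (Submodule.rank_mono this)
    exact (LinearEquiv.rank_eq (Submodule.equivSubtypeMap _ _)).le
  unfold relRank at *
  rw [← LinearMap.rank_range_add_rank_ker q, add_comm]
  exact add_le_add hk hr

end RelRank

/-! ### Homology of a graded complex modulo a subcomplex -/

section Complex

variable {K : Type u} [Field K] {A : Type}
  {E : ℕ → Type u} [∀ i, AddCommGroup (E i)] [∀ i, Module K (E i)]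

/-- `v` is a cycle modulo the submodules `J`. -/
def IsCycleMod (d : ∀ i, E (i + 1) →ₗ[K] E i) (J : ∀ i, Submodule K (E i)) : ∀ i, E i → Prop
  | 0, _ => True
  | i + 1, v => d i v ∈ J i

/-- The complex is exact modulo `J`, on the homogeneous elements. -/
def ExactMod (P : ∀ i, A → Submodule K (E i)) (d : ∀ i, E (i + 1) →ₗ[K] E i)
    (J : ∀ i, Submodule K (E i)) : Prop :=
  ∀ i a, ∀ v ∈ P i a, IsCycleMod d J i v → ∃ y ∈ P (i + 1) a, v - d i y ∈ J i

/-- The homogeneous cycles modulo `J`. -/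
def cyclesMod (P : ∀ i, A → Submodule K (E i)) (d : ∀ i, E (i + 1) →ₗ[K] E i)
    (J : ∀ i, Submodule K (E i)) : ∀ i, A → Submodule K (E i)
  | 0, a => P 0 a
  | i + 1, a => P (i + 1) a ⊓ (J i).comap (d i)

/-- The homogeneous boundaries, up to `J`. -/
def boundariesMod (P : ∀ i, A → Submodule K (E i)) (d : ∀ i, E (i + 1) →ₗ[K] E i)
    (J : ∀ i, Submodule K (E i)) (i : ℕ) (a : A) : Submodule K (E i) :=
  (P (i + 1) a).map (d i) ⊔ J i

/-- The dimension of the homology modulo `J`. -/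
def bettiMod (P : ∀ i, A → Submodule K (E i)) (d : ∀ i, E (i + 1) →ₗ[K] E i)
    (J : ∀ i, Submodule K (E i)) (i : ℕ) (a : A) : Cardinal.{u} :=
  relRank (cyclesMod P d J i a) (boundariesMod P d J i a)

variable {P : ∀ i, A → Submodule K (E i)} {d : ∀ i, E (i + 1) →ₗ[K] E i}
  {J J' : ∀ i, Submodule K (E i)}

theorem mem_cyclesMod {i : ℕ} {a : A} {v : E i} :
    v ∈ cyclesMod P d J i a ↔ v ∈ P i a ∧ IsCycleMod d J i v := by
  cases i with
  | zero => exact (and_iff_left trivial).symm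
  | succ i => exact Iff.rfl

theorem mem_boundariesMod {i : ℕ} {a : A} {v : E i} :
    v ∈ boundariesMod P d J i a ↔ ∃ y ∈ P (i + 1) a, v - d i y ∈ J i := by
  simp only [boundariesMod, Submodule.mem_sup, Submodule.mem_map]
  constructor
  · rintro ⟨_, ⟨y, hy, rfl⟩, z, hz, rfl⟩
    exact ⟨y, hy, by simpa using hz⟩
  · rintro ⟨y, hy, h⟩
    exact ⟨_, ⟨y, hy, rfl⟩, _, h, by simp⟩

variable [AddCommGroup A]

/-- `J' = J + x E`, where `x` is an endomorphism of the complex of degree `δ` which is regular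
modulo `J`. -/
structure RegularStep (P : ∀ i, A → Submodule K (E i)) (d : ∀ i, E (i + 1) →ₗ[K] E i)
    (J J' : ∀ i, Submodule K (E i)) (x : ∀ i, E i →ₗ[K] E i) (δ : A) : Prop where
  d_mem : ∀ i a, ∀ v ∈ P (i + 1) a, d i v ∈ P i a
  d_d : ∀ i v, d i (d (i + 1) v) = 0
  d_mem_sub : ∀ i, ∀ v ∈ J (i + 1), d i v ∈ J i
  d_x : ∀ i v, d i (x (i + 1) v) = x i (d i v)
  x_mem : ∀ i a, ∀ v ∈ P i (a - δ), x i v ∈ P i a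
  x_mem_sub : ∀ i, ∀ v ∈ J i, x i v ∈ J i
  sub_le : ∀ i, J i ≤ J' i
  x_mem_sub' : ∀ i v, x i v ∈ J' i
  split : ∀ i a, ∀ v ∈ P i a, v ∈ J' i → ∃ u ∈ P i (a - δ), v - x i u ∈ J i
  regular : ∀ i v, x i v ∈ J i → v ∈ J i

namespace RegularStep

variable {x : ∀ i, E i →ₗ[K] E i} {δ : A}

/-- Modulo `J`, `x (d u) = d (x u) = d v = 0`, and regularity cancels `x`. -/
theorem isCycleMod_of_sub (h : RegularStep P d J J' x δ) {i : ℕ} {v u : E i}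
    (hv : IsCycleMod d J i v) (hu : v - x i u ∈ J i) : IsCycleMod d J i u := by
  cases i with
  | zero => trivial
  | succ i =>
    apply h.regular
    rw [← h.d_x]
    have := (J i).sub_mem hv (h.d_mem_sub i _ hu)
    rwa [map_sub, sub_sub_cancel] at this

theorem isCycleMod_d (h : RegularStep P d J J' x δ) (i : ℕ) (v : E (i + 1)) :
    IsCycleMod d J i (d i v) := by
  cases i with
  | zero => trivial
  | succ i => simp [IsCycleMod, h.d_d]

/-- If `d v = x u` modulo `J`, then `u` is a cycle modulo `J`, so `u = d y` by exactness. Then `v -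
x y` is a cycle modulo `J`, hence a boundary, and `x y` dies modulo `J'`. -/
theorem exactMod (h : RegularStep P d J J' x δ) (hJ : ExactMod P d J) : ExactMod P d J' := by
  intro i a v hv hc
  cases i with
  | zero =>
    obtain ⟨y, hy, hvy⟩ := hJ 0 a v hv trivial
    exact ⟨y, hy, h.sub_le _ hvy⟩
  | succ i =>
    obtain ⟨u, hu, hvu⟩ := h.split i a _ (h.d_mem i a v hv) hc
    obtain ⟨y, hy, huy⟩ := hJ i _ u hu (h.isCycleMod_of_sub (h.isCycleMod_d i v) hvu)
    obtain ⟨z, hz, hvz⟩ := hJ (i + 1) a (v - x (i + 1) y)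
      ((P (i + 1) a).sub_mem hv (h.x_mem _ _ _ hy)) (by
        have := (J i).add_mem hvu (h.x_mem_sub i _ huy)
        simp only [IsCycleMod, map_sub, h.d_x]
        rwa [map_sub, sub_add_sub_cancel] at this)
    refine ⟨z, hz, ?_⟩
    have := (J' (i + 1)).add_mem (h.sub_le _ hvz) (h.x_mem_sub' (i + 1) y)
    rwa [sub_right_comm, sub_add_cancel] at this

/-- This is exactness at the middle term of H_i(E/J)(-δ) → H_i(E/J) → H_i(E/J'): a cycle that bounds
modulo `J'` is, up to a boundary, `x u` with `u` a cycle. -/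
theorem bettiMod_le (h : RegularStep P d J J' x δ) (i : ℕ) (a : A) :
    bettiMod P d J i a ≤ bettiMod P d J i (a - δ) + bettiMod P d J' i a := by
  refine (relRank_le_add _ (sup_le_sup_left (h.sub_le i) _)).trans (add_le_add ?_ ?_)
  · refine relRank_le_of_surjective (x i) ?_ ?_
    · rintro v ⟨hv, hv'⟩
      obtain ⟨hvP, hvc⟩ := mem_cyclesMod.1 hv
      obtain ⟨y, hy, hvy⟩ := mem_boundariesMod.1 hv'
      obtain ⟨u, hu, hvu⟩ := h.split i a _ ((P i a).sub_mem hvP (h.d_mem i a y hy)) hvy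
      refine ⟨u, mem_cyclesMod.2 ⟨hu, h.isCycleMod_of_sub ?_ hvu⟩,
        mem_boundariesMod.2 ⟨y, hy, ?_⟩⟩
      · cases i with
        | zero => trivial
        | succ i => simpa [IsCycleMod, h.d_d] using hvc
      · rwa [sub_right_comm]
    · intro b hb
      obtain ⟨y, hy, hby⟩ := mem_boundariesMod.1 hb
      refine mem_boundariesMod.2 ⟨x _ y, h.x_mem _ _ _ hy, ?_⟩
      rw [h.d_x, ← map_sub]
      exact h.x_mem_sub i _ hby
  · refine relRank_le_of_injective LinearMap.id ?_ (fun z _ hz => hz)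
    intro v hv
    obtain ⟨hvP, hvc⟩ := mem_cyclesMod.1 hv
    refine mem_cyclesMod.2 ⟨hvP, ?_⟩
    cases i with
    | zero => trivial
    | succ i => exact h.sub_le i hvc

end RegularStep

end Complex

/-! ### Homogeneous elements of graded free modules -/

section Free

variable {K : Type u} [Field K] {σ A : Type}

/-- The vectors all of whose coordinates lie in the ideal generated by the variables in `T`. -/
def varSub (K : Type u) [Field K] {σ : Type} (T : Set σ) (ι : Type u) :
    Submodule K (ι →₀ MvPolynomial σ K) where
  carrier := {v | ∀ g, v g ∈ Ideal.span (X '' T : Set (MvPolynomial σ K))}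
  add_mem' hv hw g := add_mem (hv g) (hw g)
  zero_mem' _ := zero_mem _
  smul_mem' c v hv g := by
    rw [Finsupp.smul_apply, smul_eq_C_mul]
    exact Ideal.mul_mem_left _ _ (hv g)

/-- Multiplication by the variable `X s`. -/
def mulX (K : Type u) [Field K] {σ : Type} (s : σ) (ι : Type u) :
    (ι →₀ MvPolynomial σ K) →ₗ[K] ι →₀ MvPolynomial σ K :=
  (LinearMap.lsmul (MvPolynomial σ K) _ (X s)).restrictScalars K

theorem smul_mem_varSub {T : Set σ} {ι : Type u} (p : MvPolynomial σ K)
    {v : ι →₀ MvPolynomial σ K} (hv : v ∈ varSub K T ι) : p • v ∈ varSub K T ι :=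
  fun g => Ideal.mul_mem_left _ p (hv g)

theorem map_mem_varSub {T : Set σ} {ι ι' : Type u}
    (e : ι → ι' →₀ MvPolynomial σ K) {v : ι →₀ MvPolynomial σ K}
    (hv : v ∈ varSub K T ι) :
    Finsupp.linearCombination (MvPolynomial σ K) e v ∈ varSub K T ι' := by
  intro g
  rw [Finsupp.linearCombination_apply, Finsupp.sum, Finsupp.finsetSum_apply]
  exact sum_mem fun i _ => Ideal.mul_mem_right _ _ (hv i)

theorem X_smul_mem_varSub {T : Set σ} {s : σ} (hs : s ∈ T) {ι : Type u}
    (v : ι →₀ MvPolynomial σ K) : (X s : MvPolynomial σ K) • v ∈ varSub K T ι :=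
  fun _ => Ideal.mul_mem_right _ _ (Ideal.subset_span ⟨s, hs, rfl⟩)

theorem varSub_mono {T T' : Set σ} (h : T ⊆ T') (ι : Type u) : varSub K T ι ≤ varSub K T' ι :=
  fun _ hv g => Ideal.span_mono (Set.image_mono h) (hv g)

theorem mem_varSub_empty {ι : Type u} {v : ι →₀ MvPolynomial σ K} :
    v ∈ varSub K ∅ ι ↔ v = 0 := by
  simp [varSub, Finsupp.ext_iff]

/-- A variable outside `T` is regular modulo those in `T`: if `X s * m` is divisible by some `X i`
with `i ≠ s`, so is the monomial `m`. -/
theorem mem_varSub_of_X_smul_mem {T : Set σ} {s : σ} (hs : s ∉ T) {ι : Type u}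
    {v : ι →₀ MvPolynomial σ K} (h : (X s : MvPolynomial σ K) • v ∈ varSub K T ι) : v ∈ varSub K T ι := by
  intro g
  rw [mem_ideal_span_X_image]
  intro m hm
  obtain ⟨i, hi, hmi⟩ := mem_ideal_span_X_image.1 (h g) (Finsupp.single s 1 + m) (by
    rw [mem_support_iff] at hm ⊢
    rwa [Finsupp.smul_apply, smul_eq_mul, coeff_X_mul])
  have : s ≠ i := fun h => hs (h ▸ hi)
  exact ⟨i, hi, by simpa [Finsupp.single_apply, this] using hmi⟩

theorem mem_varSub_univ {ι : Type u} {v : ι →₀ MvPolynomial σ K} :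
    v ∈ varSub K Set.univ ι ↔
      Finsupp.mapRange (constantCoeff : MvPolynomial σ K →+* K) (map_zero _) v = 0 := by
  rw [Finsupp.ext_iff]
  refine forall_congr' fun g => ?_
  rw [mem_ideal_span_X_image, Finsupp.mapRange_apply, constantCoeff_eq, Finsupp.coe_zero,
    Pi.zero_apply]
  constructor
  · intro h
    by_contra h0
    obtain ⟨i, -, hi⟩ := h 0 (mem_support_iff.2 h0)
    exact hi rfl
  · intro h m hm
    by_contra! h0
    have : m = 0 := Finsupp.ext fun i => h0 i trivial
    exact mem_support_iff.1 hm (this ▸ h)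

variable [AddCommGroup A] {w : σ → A}

theorem isWeightedHomogeneous_divMonomial_single {p : MvPolynomial σ K} {a : A}
    (hp : IsWeightedHomogeneous w p a) (s : σ) :
    IsWeightedHomogeneous w (p.divMonomial (Finsupp.single s 1)) (a - w s) := by
  intro m hm
  rw [coeff_divMonomial] at hm
  rw [← hp hm, map_add, Finsupp.weight_single, one_smul, add_sub_cancel_left]

/-- The elements of degree `a` of the free module of a stage. -/
def Stage.homPiece (w : σ → A) (T : Stage K σ A) (a : A) :
    Submodule K (T.gens →₀ MvPolynomial σ K) where
  carrier := {v | T.IsHomogeneous w v a}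
  add_mem' hv hw g := (hv g).add (hw g)
  zero_mem' _ := isWeightedHomogeneous_zero _ _ _
  smul_mem' c _ hv g := (weightedHomogeneousSubmodule K w _).smul_mem c (hv g)

/-! ### Homogeneous vectors, division by a variable, and the differential. -/

namespace Stage

variable {T : Stage K σ A}

theorem isHomogeneous_single (g : T.gens) :
    T.IsHomogeneous w (Finsupp.single g 1) (T.deg g) := by
  classical
  intro g'
  rw [Finsupp.single_apply]
  split_ifs with h
  · subst h
    rw [sub_self]
    exact isWeightedHomogeneous_one K w
  · exact isWeightedHomogeneous_zero _ _ _

theorem isHomogeneous_smul {p : MvPolynomial σ K} {b a : A}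
    {v : T.gens →₀ MvPolynomial σ K} (hp : IsWeightedHomogeneous w p b)
    (hv : T.IsHomogeneous w v a) : T.IsHomogeneous w (p • v) (b + a) := by
  intro g
  rw [add_sub_assoc]
  exact hp.mul (hv g)

theorem X_smul_mem_homPiece (s : σ) {a : A} {v : T.gens →₀ MvPolynomial σ K}
    (hv : v ∈ T.homPiece w (a - w s)) : (X s : MvPolynomial σ K) • v ∈ T.homPiece w a := by
  have := isHomogeneous_smul (isWeightedHomogeneous_X K w s) hv
  rwa [add_sub_cancel] at this

/-- Divide each coordinate by `X s`. The remainder consists of monomials of `v` free of `X s`, so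
each is divisible by a variable in `J`. -/
theorem exists_split {J : Set σ} (s : σ) {a : A} {v : T.gens →₀ MvPolynomial σ K}
    (hv : v ∈ T.homPiece w a) (hJ : v ∈ varSub K (insert s J) T.gens) :
    ∃ u ∈ T.homPiece w (a - w s), v - (X s : MvPolynomial σ K) • u ∈ varSub K J T.gens := by
  refine ⟨v.mapRange (fun p => p.divMonomial (Finsupp.single s 1)) (zero_divMonomial _), ?_, ?_⟩
  · intro g
    rw [sub_right_comm]
    exact isWeightedHomogeneous_divMonomial_single (hv g) s
  · intro g
    have h := divMonomial_add_modMonomial_single (v g) s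
    rw [Finsupp.sub_apply, Finsupp.smul_apply, smul_eq_mul, Finsupp.mapRange_apply,
      ← eq_sub_iff_add_eq'.2 h, mem_ideal_span_X_image]
    intro m hm
    rw [mem_support_iff] at hm
    have hle : ¬ Finsupp.single s 1 ≤ m := fun hle => hm (coeff_modMonomial_of_le _ hle)
    rw [coeff_modMonomial_of_not_le _ hle] at hm
    obtain ⟨i, hi, hmi⟩ := mem_ideal_span_X_image.1 (hJ g) m (mem_support_iff.2 hm)
    obtain rfl | hi := hi
    · exact absurd (by simpa [Nat.one_le_iff_ne_zero] using hmi) hle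
    · exact ⟨i, hi, hmi⟩

theorem isHomogeneous_linearCombination {T' : Stage K σ A} {a : A}
    {e : T.gens → T'.gens →₀ MvPolynomial σ K}
    (he : ∀ g, T'.IsHomogeneous w (e g) (T.deg g)) {v : T.gens →₀ MvPolynomial σ K}
    (hv : T.IsHomogeneous w v a) :
    T'.IsHomogeneous w (Finsupp.linearCombination (MvPolynomial σ K) e v) a := by
  rw [Finsupp.linearCombination_apply]
  refine (T'.homPiece w a).sum_mem fun g _ => ?_
  have := isHomogeneous_smul (hv g) (he g)
  rwa [sub_add_cancel] at this

variable (w T)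

/-- One stage up, where the syzygies are a kernel, this says that the differential squares to zero.
-/
theorem diff_mem_syz (v : T.NextGens w →₀ MvPolynomial σ K) : T.diff w v ∈ T.syz := by
  rw [diff, Finsupp.linearCombination_apply]
  exact T.syz.sum_mem fun g _ => T.syz.smul_mem _ g.2.2.1

theorem diff_single (g : T.NextGens w) (p : MvPolynomial σ K) :
    T.diff w (Finsupp.single g p) = p • g.1.2 := by
  rw [diff, Finsupp.linearCombination_single]

theorem isHomogeneous_diff {a : A} {v : T.NextGens w →₀ MvPolynomial σ K}
    (hv : (T.next w).IsHomogeneous w v a) : T.IsHomogeneous w (T.diff w v) a :=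
  isHomogeneous_linearCombination (T := T.next w) (fun g => g.2.2.2) hv

open Classical in
/-- The generator of the next free module which covers a given homogeneous syzygy. -/
def cover (a : A) (v : T.gens →₀ MvPolynomial σ K) : T.NextGens w →₀ MvPolynomial σ K :=
  if h : v ≠ 0 ∧ v ∈ T.syz ∧ T.IsHomogeneous w v a then Finsupp.single ⟨(a, v), h⟩ 1 else 0

variable {w T}

/-- This is the exactness of the canonical resolution. The zero syzygy has no generator, and the
default value 0 of `cover` serves it. -/
theorem diff_cover {a : A} {v : T.gens →₀ MvPolynomial σ K} (hv : v ∈ T.syz)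
    (ha : T.IsHomogeneous w v a) : T.diff w (T.cover w a v) = v := by
  by_cases h : v = 0
  · rw [cover, dif_neg (fun h' => h'.1 h), map_zero, h]
  · rw [cover, dif_pos ⟨h, hv, ha⟩, diff_single, one_smul]

variable (w T) in
theorem isHomogeneous_cover (a : A) (v : T.gens →₀ MvPolynomial σ K) :
    (T.next w).IsHomogeneous w (T.cover w a v) a := by
  rw [cover]
  split_ifs with h
  · exact isHomogeneous_single (T := T.next w) ⟨(a, v), h⟩
  · exact ((T.next w).homPiece w a).zero_mem

end Stage

/-- A regular step for the free modules of the canonical resolution. -/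
theorem regularStep_resolution {M : Type u} [AddCommGroup M] [Module (MvPolynomial σ K) M]
    (𝓜 : A → AddSubgroup M) (J : Set σ) {s : σ} (hs : s ∉ J) :
    RegularStep (fun i => (resolution K w 𝓜 i).homPiece w)
      (fun i => ((resolution K w 𝓜 i).diff w).restrictScalars K)
      (fun i => varSub K J (resolution K w 𝓜 i).gens)
      (fun i => varSub K (insert s J) (resolution K w 𝓜 i).gens)
      (fun i => mulX K s (resolution K w 𝓜 i).gens) (w s) where
  d_mem i _ _ hv := (resolution K w 𝓜 i).isHomogeneous_diff w hv
  d_d i v := (resolution K w 𝓜 (i + 1)).diff_mem_syz w v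
  d_mem_sub _ _ hv := map_mem_varSub _ hv
  d_x i v := map_smul ((resolution K w 𝓜 i).diff w) (X s) v
  x_mem _ _ _ hv := Stage.X_smul_mem_homPiece s hv
  x_mem_sub _ _ hv := smul_mem_varSub _ hv
  sub_le _ := varSub_mono (Set.subset_insert _ _) _
  x_mem_sub' _ v := X_smul_mem_varSub (Set.mem_insert _ _) v
  split _ _ _ hv hJ := Stage.exists_split s hv hJ
  regular _ _ h := mem_varSub_of_X_smul_mem hs h

/-- The homology of the canonical resolution modulo the variables in `J`. -/
def resBetti (w : σ → A) {M : Type u} [AddCommGroup M] [Module (MvPolynomial σ K) M]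
    (𝓜 : A → AddSubgroup M) (J : Set σ) (i : ℕ) (a : A) : Cardinal.{u} :=
  bettiMod (fun i => (resolution K w 𝓜 i).homPiece w)
    (fun i => ((resolution K w 𝓜 i).diff w).restrictScalars K)
    (fun i => varSub K J (resolution K w 𝓜 i).gens) i a

end Free

/-! ### Comparison of resolutions over two polynomial rings -/

section Comparison

variable {K : Type u} [Field K] {τ σ A' A : Type}

/-- The map of free modules, semilinear along `rename φ`, which sends the basis to `e`. -/
def semilinearMap (φ : τ → σ) {ι ι' : Type u} (e : ι → ι' →₀ MvPolynomial σ K) :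
    (ι →₀ MvPolynomial τ K) →ₗ[K] ι' →₀ MvPolynomial σ K :=
  (Finsupp.linearCombination (MvPolynomial σ K) e).restrictScalars K ∘ₗ
    Finsupp.mapRange.linearMap (rename φ : MvPolynomial τ K →ₐ[K] MvPolynomial σ K).toLinearMap

section

variable {φ : τ → σ} {ι ι' : Type u} {e : ι → ι' →₀ MvPolynomial σ K}

theorem semilinearMap_apply (v : ι →₀ MvPolynomial τ K) :
    semilinearMap φ e v = v.sum fun g p => rename φ p • e g := by
  rw [semilinearMap, LinearMap.comp_apply, LinearMap.restrictScalars_apply,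
    Finsupp.linearCombination_apply, Finsupp.mapRange.linearMap_apply,
    Finsupp.sum_mapRange_index (by simp)]
  rfl

theorem semilinearMap_single (g : ι) (p : MvPolynomial τ K) :
    semilinearMap φ e (Finsupp.single g p) = rename φ p • e g := by
  rw [semilinearMap_apply, Finsupp.sum_single_index (by simp)]

theorem semilinearMap_smul (p : MvPolynomial τ K) (v : ι →₀ MvPolynomial τ K) :
    semilinearMap φ e (p • v) = rename φ p • semilinearMap φ e v := by
  induction v using Finsupp.induction_linear with
  | zero => simp
  | add v v' h h' => rw [smul_add, map_add, h, h', map_add, smul_add]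
  | single g q => rw [Finsupp.smul_single, semilinearMap_single, semilinearMap_single, smul_eq_mul,
      map_mul, mul_smul]

theorem semilinearMap_mem_varSub {J : Set τ} {v : ι →₀ MvPolynomial τ K}
    (hv : v ∈ varSub K J ι) : semilinearMap φ e v ∈ varSub K (φ '' J) ι' := by
  refine map_mem_varSub e fun g => ?_
  have : (Ideal.span (X '' J : Set (MvPolynomial τ K))).map (rename φ : _ →ₐ[K] _) =
      Ideal.span (X '' (φ '' J) : Set (MvPolynomial σ K)) := by
    rw [Ideal.map_span, Set.image_image, Set.image_image]
    simp
  rw [← this]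
  exact Ideal.mem_map_of_mem _ (hv g)

end

theorem isWeightedHomogeneous_rename [AddCommGroup A'] [AddCommGroup A] {w' : τ → A'} {w : σ → A}
    {φ : τ → σ} {β : A' →+ A} (h : ∀ s, w (φ s) = β (w' s)) {p : MvPolynomial τ K} {a : A'}
    (hp : IsWeightedHomogeneous w' p a) : IsWeightedHomogeneous w (rename φ p) (β a) := by
  intro m hm
  obtain ⟨m', rfl, hm'⟩ := coeff_rename_ne_zero _ _ _ hm
  rw [← hp hm', Finsupp.weight_apply, Finsupp.weight_apply,
    Finsupp.sum_mapDomain_index (by simp) (by simp [add_smul]), map_finsuppSum]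
  simp [h]

/-! ### The augmentation onto the module and its homogeneous preimages. -/

section Cover

variable {M : Type u} [AddCommGroup M] [Module (MvPolynomial σ K) M]
  (𝓜 : A → AddSubgroup M)

/-- The map from the first free module of the canonical resolution to the module. -/
def augmentation (K : Type u) [Field K] {σ : Type} [Module (MvPolynomial σ K) M] :
    ((firstStage (K := K) (σ := σ) 𝓜).gens →₀ MvPolynomial σ K) →ₗ[MvPolynomial σ K] M :=
  Finsupp.linearCombination _ fun g : (firstStage (K := K) (σ := σ) 𝓜).gens => g.1.2

open Classical in
/-- The generator of the first free module which covers a given homogeneous element. -/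
def firstCover (K : Type u) [Field K] (σ : Type) [Module (MvPolynomial σ K) M] (a : A) (m : M) :
    (firstStage (K := K) (σ := σ) 𝓜).gens →₀ MvPolynomial σ K :=
  if h : m ≠ 0 ∧ m ∈ 𝓜 a then Finsupp.single ⟨(a, m), h⟩ 1 else 0

variable {𝓜}

theorem augmentation_single (g : (firstStage (K := K) (σ := σ) 𝓜).gens) (p : MvPolynomial σ K) :
    augmentation 𝓜 K (Finsupp.single g p) = p • g.1.2 := by
  rw [augmentation, Finsupp.linearCombination_single]

theorem augmentation_firstCover {a : A} {m : M} (ha : m ∈ 𝓜 a) :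
    augmentation 𝓜 K (firstCover 𝓜 K σ a m) = m := by
  by_cases h : m = 0
  · rw [firstCover, dif_neg (fun h' => h'.1 h), map_zero, h]
  · rw [firstCover, dif_pos ⟨h, ha⟩, augmentation_single, one_smul]

variable (𝓜) in
theorem isHomogeneous_firstCover [AddCommGroup A] (w : σ → A) (a : A) (m : M) :
    (firstStage 𝓜).IsHomogeneous w (firstCover 𝓜 K σ a m) a := by
  rw [firstCover]
  split_ifs with h
  · exact Stage.isHomogeneous_single (T := firstStage 𝓜) ⟨(a, m), h⟩
  · exact ((firstStage 𝓜).homPiece w a).zero_mem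

end Cover

variable [AddCommGroup A'] [AddCommGroup A] {w' : τ → A'} {w : σ → A}
  {M : Type u} [AddCommGroup M] [Module (MvPolynomial τ K) M]
  {M' : Type u} [AddCommGroup M'] [Module (MvPolynomial σ K) M']

/-- The images of the generators under the comparison map between canonical resolutions which
lifts `ρ : M → M'`. -/
def comparisonGen (φ : τ → σ) (w' : τ → A') (w : σ → A) (α : A' → A) (𝓜 : A' → AddSubgroup M)
    (𝓜' : A → AddSubgroup M') (ρ : M →+ M') : ∀ i,
    (resolution K w' 𝓜 i).gens → (resolution K w 𝓜' i).gens →₀ MvPolynomial σ K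
  | 0 => fun g => firstCover 𝓜' K σ (α g.1.1) (ρ g.1.2)
  | i + 1 => fun g => (resolution K w 𝓜' i).cover w (α g.1.1)
      (semilinearMap φ (comparisonGen φ w' w α 𝓜 𝓜' ρ i) g.1.2)

/-- The comparison map between canonical resolutions which lifts `ρ`. -/
abbrev comparison (φ : τ → σ) (w' : τ → A') (w : σ → A) (α : A' → A) (𝓜 : A' → AddSubgroup M)
    (𝓜' : A → AddSubgroup M') (ρ : M →+ M') (i : ℕ) :
    ((resolution K w' 𝓜 i).gens →₀ MvPolynomial τ K) →ₗ[K]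
      (resolution K w 𝓜' i).gens →₀ MvPolynomial σ K :=
  semilinearMap φ (comparisonGen φ w' w α 𝓜 𝓜' ρ i)

/-- `ρ` identifies `𝓜 a` with `𝓜' (α a)`, and is semilinear along `rename φ`. -/
structure StrandEquiv (φ : τ → σ) (w' : τ → A') (w : σ → A) (β : A' →+ A) (α : A' → A)
    (𝓜 : A' → AddSubgroup M) (𝓜' : A → AddSubgroup M') (ρ : M →+ M') : Prop where
  injective_var : Function.Injective φ
  weight : ∀ s, w (φ s) = β (w' s)
  shift : ∀ a b, α (a + b) = β a + α b
  map_smul : ∀ (p : MvPolynomial τ K) m, ρ (p • m) = rename φ p • ρ m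
  injective : Function.Injective ρ
  map_mem : ∀ a, ∀ m ∈ 𝓜 a, ρ m ∈ 𝓜' (α a)
  smul_mem : ∀ a b, ∀ p : MvPolynomial σ K, IsWeightedHomogeneous w p b → ∀ m ∈ 𝓜' a,
    p • m ∈ 𝓜' (b + a)
  exists_eq : ∀ a, ∀ m' ∈ 𝓜' (α a), ∃ m ∈ 𝓜 a, ρ m = m'

namespace StrandEquiv

variable {φ : τ → σ} {β : A' →+ A} {α : A' → A} {𝓜 : A' → AddSubgroup M}
  {𝓜' : A → AddSubgroup M'} {ρ : M →+ M'}

theorem isHomogeneous_semilinearMap (h : StrandEquiv (K := K) φ w' w β α 𝓜 𝓜' ρ)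
    {T : Stage K τ A'} {T' : Stage K σ A} {e : T.gens → T'.gens →₀ MvPolynomial σ K}
    (he : ∀ g, T'.IsHomogeneous w (e g) (α (T.deg g))) {a : A'}
    {v : T.gens →₀ MvPolynomial τ K} (hv : T.IsHomogeneous w' v a) :
    T'.IsHomogeneous w (semilinearMap φ e v) (α a) := by
  rw [semilinearMap_apply]
  refine (T'.homPiece w (α a)).sum_mem fun g _ => ?_
  have := Stage.isHomogeneous_smul (isWeightedHomogeneous_rename h.weight (hv g)) (he g)
  rwa [← h.shift, sub_add_cancel] at this

theorem augmentation_comparison (h : StrandEquiv (K := K) φ w' w β α 𝓜 𝓜' ρ)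
    (v : (firstStage (K := K) (σ := τ) 𝓜).gens →₀ MvPolynomial τ K) :
    augmentation 𝓜' K (semilinearMap φ (fun g : (firstStage (K := K) (σ := τ) 𝓜).gens =>
      firstCover 𝓜' K σ (α g.1.1) (ρ g.1.2)) v) = ρ (augmentation 𝓜 K v) := by
  induction v using Finsupp.induction_linear with
  | zero => simp
  | add v v' h h' => simp only [map_add, h, h']
  | single g p =>
    rw [semilinearMap_single, LinearMap.map_smul, augmentation_single, h.map_smul,
      augmentation_firstCover (h.map_mem _ _ g.2.2)]

theorem augmentation_mem (h : StrandEquiv (K := K) φ w' w β α 𝓜 𝓜' ρ) {a : A}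
    {v : (firstStage (K := K) (σ := σ) 𝓜').gens →₀ MvPolynomial σ K}
    (hv : (firstStage 𝓜').IsHomogeneous w v a) : augmentation 𝓜' K v ∈ 𝓜' a := by
  rw [augmentation, Finsupp.linearCombination_apply]
  refine (𝓜' a).sum_mem fun g _ => ?_
  have := h.smul_mem _ _ _ (hv g) _ g.2.2
  rwa [sub_add_cancel] at this

/-- By semilinearity it suffices to look at a basis element, where `cover` chooses a preimage of the
image of the syzygy it names. That image must be a homogeneous syzygy for the choice to be a true
preimage. -/
theorem diff_semilinearMap_cover (h : StrandEquiv (K := K) φ w' w β α 𝓜 𝓜' ρ)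
    {T : Stage K τ A'} {T' : Stage K σ A} {e : T.gens → T'.gens →₀ MvPolynomial σ K}
    (he : ∀ g, T'.IsHomogeneous w (e g) (α (T.deg g)))
    (hsyz : ∀ v ∈ T.syz, semilinearMap φ e v ∈ T'.syz)
    (v : T.NextGens w' →₀ MvPolynomial τ K) :
    T'.diff w (semilinearMap φ (fun g : T.NextGens w' =>
      T'.cover w (α g.1.1) (semilinearMap φ e g.1.2)) v) = semilinearMap φ e (T.diff w' v) := by
  induction v using Finsupp.induction_linear with
  | zero => simp
  | add v v' h h' => simp only [map_add, h, h']
  | single g p =>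
    rw [semilinearMap_single, LinearMap.map_smul, Stage.diff_single, semilinearMap_smul, Stage.diff_cover (hsyz _ g.2.2.1)
      (h.isHomogeneous_semilinearMap he g.2.2.2)]

theorem isHomogeneous_comparisonGen (i : ℕ) (g : (resolution K w' 𝓜 i).gens) :
    (resolution K w 𝓜' i).IsHomogeneous w (comparisonGen φ w' w α 𝓜 𝓜' ρ i g)
      (α ((resolution K w' 𝓜 i).deg g)) := by
  cases i with
  | zero => exact isHomogeneous_firstCover 𝓜' w _ _
  | succ i => exact Stage.isHomogeneous_cover w (resolution K w 𝓜' i) _ _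

theorem isHomogeneous_comparison (h : StrandEquiv (K := K) φ w' w β α 𝓜 𝓜' ρ) (i : ℕ) {a : A'}
    {v : (resolution K w' 𝓜 i).gens →₀ MvPolynomial τ K}
    (hv : (resolution K w' 𝓜 i).IsHomogeneous w' v a) :
    (resolution K w 𝓜' i).IsHomogeneous w (comparison φ w' w α 𝓜 𝓜' ρ i v) (α a) :=
  h.isHomogeneous_semilinearMap (isHomogeneous_comparisonGen i) hv

/-- This comes before the chain map identity, since `cover` is a preimage only on syzygies. Stage 0
holds because the comparison lifts `ρ`; each later stage uses the identity one stage below. -/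
theorem comparison_mem_syz (h : StrandEquiv (K := K) φ w' w β α 𝓜 𝓜' ρ) (i : ℕ) :
    ∀ v ∈ (resolution K w' 𝓜 i).syz,
      comparison φ w' w α 𝓜 𝓜' ρ i v ∈ (resolution K w 𝓜' i).syz := by
  induction i with
  | zero =>
    intro v hv
    exact (h.augmentation_comparison v).trans ((congrArg ρ hv).trans (map_zero ρ))
  | succ i ih =>
    intro v hv
    exact (h.diff_semilinearMap_cover (isHomogeneous_comparisonGen i) ih v).trans
      ((congrArg (comparison φ w' w α 𝓜 𝓜' ρ i) hv).trans (map_zero _))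

theorem diff_comparison (h : StrandEquiv (K := K) φ w' w β α 𝓜 𝓜' ρ) (i : ℕ)
    (v : (resolution K w' 𝓜 (i + 1)).gens →₀ MvPolynomial τ K) :
    (resolution K w 𝓜' i).diff w (comparison φ w' w α 𝓜 𝓜' ρ (i + 1) v) =
      comparison φ w' w α 𝓜 𝓜' ρ i ((resolution K w' 𝓜 i).diff w' v) :=
  h.diff_semilinearMap_cover (isHomogeneous_comparisonGen i) (h.comparison_mem_syz i) v

/-- Boundaries have zero augmentation, so injectivity of `ρ` applies. This gives exactness of the
cone in homological degree 1. -/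
theorem mem_syz_of_comparison_eq_diff (h : StrandEquiv (K := K) φ w' w β α 𝓜 𝓜' ρ)
    {v : (resolution K w' 𝓜 0).gens →₀ MvPolynomial τ K}
    {u : (resolution K w 𝓜' 1).gens →₀ MvPolynomial σ K}
    (hv : comparison φ w' w α 𝓜 𝓜' ρ 0 v = (resolution K w 𝓜' 0).diff w u) :
    v ∈ (resolution K w' 𝓜 0).syz := by
  have h0 : comparison φ w' w α 𝓜 𝓜' ρ 0 v ∈ (resolution K w 𝓜' 0).syz :=
    hv ▸ (resolution K w 𝓜' 0).diff_mem_syz w u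
  exact h.injective ((h.augmentation_comparison v).symm.trans (h0.trans (map_zero ρ).symm))

end StrandEquiv

end Comparison

/-! ### The mapping cone of the comparison map -/

section Cone

variable {K : Type u} [Field K] {τ σ A' A : Type} [AddCommGroup A'] [AddCommGroup A]
  {w' : τ → A'} {w : σ → A}
  {M : Type u} [AddCommGroup M] [Module (MvPolynomial τ K) M]
  {M' : Type u} [AddCommGroup M'] [Module (MvPolynomial σ K) M']

/-- The canonical resolution, moved up by one homological degree. -/
def shiftedResolution (K : Type u) [Field K] (w' : τ → A') [Module (MvPolynomial τ K) M]
    (𝓜 : A' → AddSubgroup M) : ℕ → Stage K τ A'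
  | 0 => ⟨PEmpty, PEmpty.elim, ⊥⟩
  | i + 1 => resolution K w' 𝓜 i

/-- The differential of the shifted resolution. -/
def shiftedDiff (K : Type u) [Field K] (w' : τ → A') [Module (MvPolynomial τ K) M]
    (𝓜 : A' → AddSubgroup M) : ∀ i, ((shiftedResolution K w' 𝓜 (i + 1)).gens →₀ MvPolynomial τ K)
      →ₗ[MvPolynomial τ K] (shiftedResolution K w' 𝓜 i).gens →₀ MvPolynomial τ K
  | 0 => 0
  | i + 1 => (resolution K w' 𝓜 i).diff w'

theorem shiftedDiff_shiftedDiff (𝓜 : A' → AddSubgroup M) (i : ℕ)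
    (v : (shiftedResolution K w' 𝓜 (i + 2)).gens →₀ MvPolynomial τ K) :
    shiftedDiff K w' 𝓜 i (shiftedDiff K w' 𝓜 (i + 1) v) = 0 := by
  cases i with
  | zero => rfl
  | succ i => exact (resolution K w' 𝓜 (i + 1)).diff_mem_syz w' v

theorem isHomogeneous_shiftedDiff (𝓜 : A' → AddSubgroup M) (i : ℕ) {a : A'}
    {v : (shiftedResolution K w' 𝓜 (i + 1)).gens →₀ MvPolynomial τ K}
    (hv : v ∈ (shiftedResolution K w' 𝓜 (i + 1)).homPiece w' a) :
    shiftedDiff K w' 𝓜 i v ∈ (shiftedResolution K w' 𝓜 i).homPiece w' a := by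
  cases i with
  | zero => exact Submodule.zero_mem _
  | succ i => exact (resolution K w' 𝓜 i).isHomogeneous_diff w' hv

theorem shiftedDiff_mem_varSub (𝓜 : A' → AddSubgroup M) (i : ℕ) {J : Set τ}
    {v : (shiftedResolution K w' 𝓜 (i + 1)).gens →₀ MvPolynomial τ K}
    (hv : v ∈ varSub K J _) : shiftedDiff K w' 𝓜 i v ∈ varSub K J _ := by
  cases i with
  | zero => exact Submodule.zero_mem _
  | succ i => exact map_mem_varSub _ hv

/-- The free modules of the mapping cone of the comparison map. -/
abbrev Cone (K : Type u) [Field K] (w' : τ → A') (w : σ → A) [Module (MvPolynomial τ K) M]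
    [Module (MvPolynomial σ K) M'] (𝓜 : A' → AddSubgroup M) (𝓜' : A → AddSubgroup M') (i : ℕ) :
    Type u :=
  ((shiftedResolution K w' 𝓜 i).gens →₀ MvPolynomial τ K) ×
    ((resolution K w 𝓜' i).gens →₀ MvPolynomial σ K)

/-- The elements of degree `a` of the mapping cone. -/
def conePiece (w' : τ → A') (w : σ → A) (α : A' → A) (𝓜 : A' → AddSubgroup M)
    (𝓜' : A → AddSubgroup M') (i : ℕ) (a : A') : Submodule K (Cone K w' w 𝓜 𝓜' i) :=
  ((shiftedResolution K w' 𝓜 i).homPiece w' a).prod ((resolution K w 𝓜' i).homPiece w (α a))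

/-- The multiples of the variables in `J` in the mapping cone. -/
def coneSub (φ : τ → σ) (w' : τ → A') (w : σ → A) (𝓜 : A' → AddSubgroup M)
    (𝓜' : A → AddSubgroup M') (J : Set τ) (i : ℕ) : Submodule K (Cone K w' w 𝓜 𝓜' i) :=
  (varSub K J _).prod (varSub K (φ '' J) _)

/-- Multiplication by a variable on the mapping cone. -/
def coneX (φ : τ → σ) (w' : τ → A') (w : σ → A) (𝓜 : A' → AddSubgroup M)
    (𝓜' : A → AddSubgroup M') (s : τ) (i : ℕ) : Cone K w' w 𝓜 𝓜' i →ₗ[K] Cone K w' w 𝓜 𝓜' i :=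
  LinearMap.prodMap (mulX K s _) (mulX K (φ s) _)

/-- The differential of the mapping cone. -/
def coneDiff (φ : τ → σ) (w' : τ → A') (w : σ → A) (α : A' → A) (𝓜 : A' → AddSubgroup M)
    (𝓜' : A → AddSubgroup M') (ρ : M →+ M') (i : ℕ) :
    Cone K w' w 𝓜 𝓜' (i + 1) →ₗ[K] Cone K w' w 𝓜 𝓜' i :=
  LinearMap.prod (-((shiftedDiff K w' 𝓜 i).restrictScalars K ∘ₗ LinearMap.fst K _ _))
    (LinearMap.coprod (comparison φ w' w α 𝓜 𝓜' ρ i)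
      (((resolution K w 𝓜' i).diff w).restrictScalars K))

namespace StrandEquiv

variable {φ : τ → σ} {β : A' →+ A} {α : A' → A} {𝓜 : A' → AddSubgroup M}
  {𝓜' : A → AddSubgroup M'} {ρ : M →+ M'}

theorem comparison_shiftedDiff (h : StrandEquiv (K := K) φ w' w β α 𝓜 𝓜' ρ) (i : ℕ)
    (v : (resolution K w' 𝓜 (i + 1)).gens →₀ MvPolynomial τ K) :
    comparison φ w' w α 𝓜 𝓜' ρ i (shiftedDiff K w' 𝓜 (i + 1) v) =
      (resolution K w 𝓜' i).diff w (comparison φ w' w α 𝓜 𝓜' ρ (i + 1) v) :=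
  (h.diff_comparison i v).symm

theorem shift_sub (h : StrandEquiv (K := K) φ w' w β α 𝓜 𝓜' ρ) (a : A') (s : τ) :
    α (a - w' s) = α a - w (φ s) := by
  rw [h.weight, eq_sub_iff_add_eq', ← h.shift, add_sub_cancel]

/-- `X s` acts on the source and `X (φ s)` on the target, compatibly with the semilinear comparison.
Injectivity of `φ` keeps `φ s` outside `φ '' J`, which gives regularity on the target. -/
theorem regularStep_cone (h : StrandEquiv (K := K) φ w' w β α 𝓜 𝓜' ρ) (J : Set τ) {s : τ}
    (hs : s ∉ J) :
    RegularStep (conePiece w' w α 𝓜 𝓜') (coneDiff (K := K) φ w' w α 𝓜 𝓜' ρ)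
      (coneSub φ w' w 𝓜 𝓜' J) (coneSub φ w' w 𝓜 𝓜' (insert s J)) (coneX φ w' w 𝓜 𝓜' s)
      (w' s) where
  d_mem i a v hv :=
    ⟨Submodule.neg_mem _ (isHomogeneous_shiftedDiff 𝓜 i hv.1),
      Submodule.add_mem _ (h.isHomogeneous_comparison i hv.1)
        ((resolution K w 𝓜' i).isHomogeneous_diff w hv.2)⟩
  d_d i v := by
    refine Prod.ext ?_ ?_
    · change -shiftedDiff K w' 𝓜 i (-shiftedDiff K w' 𝓜 (i + 1) v.1) = 0
      rw [map_neg, shiftedDiff_shiftedDiff, neg_zero, neg_zero]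
    · have h1 : (resolution K w 𝓜' i).diff w ((resolution K w 𝓜' (i + 1)).diff w v.2) = 0 :=
        (resolution K w 𝓜' (i + 1)).diff_mem_syz w v.2
      have h2 := h.comparison_shiftedDiff i v.1
      change comparison φ w' w α 𝓜 𝓜' ρ i (-shiftedDiff K w' 𝓜 (i + 1) v.1) +
        (resolution K w 𝓜' i).diff w (comparison φ w' w α 𝓜 𝓜' ρ (i + 1) v.1 +
          (resolution K w 𝓜' (i + 1)).diff w v.2) = 0
      refine (congrArg₂ (· + ·) ((map_neg _ _).trans (congrArg Neg.neg h2)) ((map_add _ _ _).trans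
        (congrArg₂ (· + ·) rfl h1))).trans ?_
      rw [add_zero, neg_add_cancel]
  d_mem_sub i v hv :=
    ⟨Submodule.neg_mem _ (shiftedDiff_mem_varSub 𝓜 i hv.1),
      Submodule.add_mem _ (semilinearMap_mem_varSub hv.1) (map_mem_varSub _ hv.2)⟩
  d_x i v := by
    refine Prod.ext ?_ ?_
    · change -shiftedDiff K w' 𝓜 i ((X s : MvPolynomial τ K) • v.1) =
        (X s : MvPolynomial τ K) • -shiftedDiff K w' 𝓜 i v.1
      rw [LinearMap.map_smul, smul_neg]
    · have h1 : comparison φ w' w α 𝓜 𝓜' ρ i ((X s : MvPolynomial τ K) • v.1) = _ :=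
        semilinearMap_smul _ _
      rw [rename_X] at h1
      change comparison φ w' w α 𝓜 𝓜' ρ i ((X s : MvPolynomial τ K) • v.1) +
        (resolution K w 𝓜' i).diff w ((X (φ s) : MvPolynomial σ K) • v.2) =
        (X (φ s) : MvPolynomial σ K) • (comparison φ w' w α 𝓜 𝓜' ρ i v.1 +
          (resolution K w 𝓜' i).diff w v.2)
      refine (congrArg₂ (· + ·) h1 (LinearMap.map_smul _ _ _)).trans (smul_add _ _ _).symm
  x_mem i a v hv :=
    ⟨Stage.X_smul_mem_homPiece s hv.1, Stage.X_smul_mem_homPiece (φ s) (h.shift_sub a s ▸ hv.2)⟩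
  x_mem_sub _ _ hv := ⟨smul_mem_varSub _ hv.1, smul_mem_varSub _ hv.2⟩
  sub_le _ := Submodule.prod_mono (varSub_mono (Set.subset_insert _ _) _)
    (varSub_mono (Set.image_mono (Set.subset_insert _ _)) _)
  x_mem_sub' _ v := ⟨X_smul_mem_varSub (Set.mem_insert _ _) v.1,
    X_smul_mem_varSub (Set.mem_image_of_mem _ (Set.mem_insert _ _)) v.2⟩
  split i a v hv hJ := by
    obtain ⟨u, hu, hvu⟩ := Stage.exists_split s hv.1 hJ.1
    obtain ⟨u', hu', hvu'⟩ := Stage.exists_split (φ s) hv.2 (Set.image_insert_eq ▸ hJ.2)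
    exact ⟨(u, u'), ⟨hu, (h.shift_sub a s).symm ▸ hu'⟩, ⟨hvu, hvu'⟩⟩
  regular i v hv := ⟨mem_varSub_of_X_smul_mem hs hv.1, mem_varSub_of_X_smul_mem
    (fun hs' => hs ((h.injective_var.mem_set_image).1 hs')) hv.2⟩

/-- The cone pairs degree `a` with degree `α a`, so it sees only the strand. There `ρ` is onto,
giving exactness in homological degree 0, and injective, giving it in degree 1; above that, both
resolutions are exact. -/
theorem exactMod_cone_empty (h : StrandEquiv (K := K) φ w' w β α 𝓜 𝓜' ρ) :
    ExactMod (conePiece w' w α 𝓜 𝓜') (coneDiff (K := K) φ w' w α 𝓜 𝓜' ρ)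
      (coneSub φ w' w 𝓜 𝓜' ∅) := by
  have mem_coneSub : ∀ {i : ℕ} {v : Cone K w' w 𝓜 𝓜' i},
      v ∈ coneSub (K := K) φ w' w 𝓜 𝓜' ∅ i ↔ v = 0 := by
    intro i v
    rw [coneSub, Submodule.mem_prod, Set.image_empty, mem_varSub_empty, mem_varSub_empty]
    exact (Prod.ext_iff (x := v) (y := 0)).symm
  rintro i a ⟨v, u⟩ ⟨hv, hu⟩ hc
  cases i with
  | zero =>
    obtain ⟨m, hm, hmu⟩ := h.exists_eq a _ (h.augmentation_mem hu)
    let c : (resolution K w' 𝓜 0).gens →₀ MvPolynomial τ K := firstCover 𝓜 K τ a m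
    have hc : c ∈ (resolution K w' 𝓜 0).homPiece w' a := isHomogeneous_firstCover 𝓜 w' a m
    have huc : u - comparison φ w' w α 𝓜 𝓜' ρ 0 c ∈ (resolution K w 𝓜' 0).syz := by
      change augmentation 𝓜' K (u - comparison φ w' w α 𝓜 𝓜' ρ 0 c) = 0
      refine (map_sub (augmentation 𝓜' K) _ _).trans (sub_eq_zero.2 ?_)
      exact hmu.symm.trans ((congrArg ρ (augmentation_firstCover hm)).symm.trans
        (h.augmentation_comparison c).symm)
    refine ⟨(c, (resolution K w 𝓜' 0).cover w (α a) (u - comparison φ w' w α 𝓜 𝓜' ρ 0 c)),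
      ⟨hc, Stage.isHomogeneous_cover w _ _ _⟩, mem_coneSub.2 ?_⟩
    have h1 := Stage.diff_cover huc
      (((resolution K w 𝓜' 0).homPiece w (α a)).sub_mem hu (h.isHomogeneous_comparison 0 hc))
    refine Prod.ext (Finsupp.ext fun g => g.elim) (sub_eq_zero.2 ?_)
    exact ((congrArg₂ (· + ·) rfl h1).trans (add_sub_cancel _ _)).symm
  | succ i =>
    obtain ⟨hc1, hc2⟩ := Prod.ext_iff.1 (mem_coneSub.1 hc)
    change -shiftedDiff K w' 𝓜 i v = 0 at hc1
    change comparison φ w' w α 𝓜 𝓜' ρ i v + (resolution K w 𝓜' i).diff w u = 0 at hc2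
    -- For `i = 0` the shifted differential is zero and `hc1` is empty; the information is in `hc2`.
    have hsyz : v ∈ (resolution K w' 𝓜 i).syz := by
      cases i with
      | zero =>
        exact h.mem_syz_of_comparison_eq_diff (u := -u)
          ((eq_neg_of_add_eq_zero_left hc2).trans (map_neg _ _).symm)
      | succ i => exact neg_eq_zero.1 hc1
    let y : (resolution K w' 𝓜 (i + 1)).gens →₀ MvPolynomial τ K :=
      (resolution K w' 𝓜 i).cover w' a v
    have hy : y ∈ (resolution K w' 𝓜 (i + 1)).homPiece w' a := Stage.isHomogeneous_cover w' _ _ _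
    have hyv : (resolution K w' 𝓜 i).diff w' y = v := Stage.diff_cover hsyz hv
    have hz : u + comparison φ w' w α 𝓜 𝓜' ρ (i + 1) y ∈ (resolution K w 𝓜' (i + 1)).syz := by
      change (resolution K w 𝓜' i).diff w (u + comparison φ w' w α 𝓜 𝓜' ρ (i + 1) y) = 0
      refine (map_add _ _ _).trans ((congrArg₂ (· + ·) rfl ((h.diff_comparison i y).trans
        (congrArg (comparison φ w' w α 𝓜 𝓜' ρ i) hyv))).trans ?_)
      rwa [add_comm]
    have h1 := Stage.diff_cover hz (((resolution K w 𝓜' (i + 1)).homPiece w (α a)).add_mem hu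
      (h.isHomogeneous_comparison (i + 1) hy))
    -- The sign in `-y` offsets that of the cone differential; the second entry cancels the
    -- comparison of `-y` and leaves `u`.
    refine ⟨(-y, (resolution K w 𝓜' (i + 1)).cover w (α a)
      (u + comparison φ w' w α 𝓜 𝓜' ρ (i + 1) y)), ⟨Submodule.neg_mem _ hy,
      Stage.isHomogeneous_cover w _ _ _⟩, mem_coneSub.2 (sub_eq_zero.2 (Prod.ext ?_ ?_))⟩
    · change v = -(resolution K w' 𝓜 i).diff w' (-y)
      exact hyv.symm.trans (neg_eq_iff_eq_neg.1 (map_neg _ _).symm)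
    · change u = comparison φ w' w α 𝓜 𝓜' ρ (i + 1) (-y) + (resolution K w 𝓜' (i + 1)).diff w
        ((resolution K w 𝓜' (i + 1)).cover w (α a) (u + comparison φ w' w α 𝓜 𝓜' ρ (i + 1) y))
      rw [h1, map_neg, neg_add_cancel_comm_assoc]

theorem exactMod_cone [Finite τ] (h : StrandEquiv (K := K) φ w' w β α 𝓜 𝓜' ρ) :
    ExactMod (conePiece w' w α 𝓜 𝓜') (coneDiff (K := K) φ w' w α 𝓜 𝓜' ρ)
      (coneSub φ w' w 𝓜 𝓜' Set.univ) := by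
  refine Set.Finite.induction_on Set.univ Set.finite_univ h.exactMod_cone_empty ?_
  intro s J hs _ hJ
  exact (h.regularStep_cone J hs).exactMod hJ

/-- The comparison is injective on homology: if it sends the cycle `v` to the boundary of `y`, then
`(v, -y)` is a cycle of the cone. Exactness makes it a boundary, whose first component bounds `v`.
-/
theorem resBetti_le [Finite τ] (h : StrandEquiv (K := K) φ w' w β α 𝓜 𝓜' ρ) (i : ℕ) (a : A') :
    resBetti (K := K) w' 𝓜 Set.univ i a ≤ resBetti (K := K) w 𝓜' (Set.range φ) i (α a) := by
  rw [← Set.image_univ]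
  refine relRank_le_of_injective (comparison φ w' w α 𝓜 𝓜' ρ i) ?_ ?_
  · intro v hv
    obtain ⟨hv, hc⟩ := mem_cyclesMod.1 hv
    refine mem_cyclesMod.2 ⟨h.isHomogeneous_comparison i hv, ?_⟩
    cases i with
    | zero => trivial
    | succ i => 
      have h1 := semilinearMap_mem_varSub (φ := φ) (e := comparisonGen φ w' w α 𝓜 𝓜' ρ i) hc
      exact (congrArg (· ∈ varSub K _ (resolution K w 𝓜' i).gens) (h.diff_comparison i v)).mpr h1
  · intro v hv hb
    obtain ⟨hv, hc⟩ := mem_cyclesMod.1 hv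
    obtain ⟨y, hy, hvy⟩ := mem_boundariesMod.1 hb
    obtain ⟨⟨z, z'⟩, hz, hvz⟩ := h.exactMod_cone (i + 1) a (v, -y)
      ⟨hv, Submodule.neg_mem _ hy⟩ ⟨by
        cases i with
        | zero => exact Submodule.neg_mem _ (Submodule.zero_mem _)
        | succ i => exact Submodule.neg_mem _ hc, by
        have : comparison φ w' w α 𝓜 𝓜' ρ i v + (resolution K w 𝓜' i).diff w (-y) ∈
            varSub K (φ '' Set.univ) _ := by
          refine (congrArg (· ∈ varSub K (φ '' Set.univ) (resolution K w 𝓜' i).gens)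
            ((congrArg₂ (· + ·) rfl (map_neg _ _)).trans (sub_eq_add_neg _ _).symm)).mpr hvy
        exact this⟩
    refine mem_boundariesMod.2 ⟨-z, Submodule.neg_mem _ hz.1, ?_⟩
    have h1 : v - -(resolution K w' 𝓜 i).diff w' z ∈ varSub K Set.univ _ := hvz.1
    exact (congrArg (fun t => v - t ∈ varSub K Set.univ (resolution K w' 𝓜 i).gens)
      (map_neg ((resolution K w' 𝓜 i).diff w') z)).mpr h1

end StrandEquiv

end Cone

/-! ### Reduction modulo all the variables -/

section Bar

variable {K : Type u} [Field K] {σ A : Type}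

/-- The constant coefficients of a vector. -/
def bar (K : Type u) [Field K] (σ : Type) (ι : Type u) :
    (ι →₀ MvPolynomial σ K) →ₗ[K] ι →₀ K where
  toFun v := Finsupp.mapRange (constantCoeff : MvPolynomial σ K →+* K) (map_zero _) v
  map_add' v v' := Finsupp.mapRange_add (map_add _) v v'
  map_smul' c v := by ext; simp

/-- The vector of constant polynomials with given values. -/
def unbar (K : Type u) [Field K] (σ : Type) (ι : Type u) :
    (ι →₀ K) →ₗ[K] ι →₀ MvPolynomial σ K :=
  Finsupp.mapRange.linearMap (Algebra.linearMap K (MvPolynomial σ K))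

@[simp]
theorem bar_apply {ι : Type u} (v : ι →₀ MvPolynomial σ K) (g : ι) :
    bar K σ ι v g = constantCoeff (v g) := rfl

@[simp]
theorem unbar_apply {ι : Type u} (v : ι →₀ K) (g : ι) : unbar K σ ι v g = C (v g) := rfl

@[simp]
theorem bar_unbar {ι : Type u} (v : ι →₀ K) : bar K σ ι (unbar K σ ι v) = v := by
  ext
  simp

theorem mem_varSub_univ_iff_bar {ι : Type u} {v : ι →₀ MvPolynomial σ K} :
    v ∈ varSub K Set.univ ι ↔ bar K σ ι v = 0 := mem_varSub_univ

variable [AddCommGroup A] {w : σ → A}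

namespace Stage

variable {T : Stage K σ A}

variable (w) in
theorem bar_diff (v : T.NextGens w →₀ MvPolynomial σ K) :
    bar K σ _ (T.diff w v) = T.diffBar w (bar K σ _ v) := by
  induction v using Finsupp.induction_linear with
  | zero => simp
  | add v v' h h' => simp only [map_add, h, h']
  | single g p =>
    have : bar K σ (T.NextGens w) (Finsupp.single g p) = Finsupp.single g (constantCoeff p) :=
      Finsupp.mapRange_single (hf := map_zero _)
    rw [this, diff_single, diffBar, Finsupp.linearCombination_single]
    ext g'
    simp

theorem bar_mem_barPiece {a : A} {v : T.gens →₀ MvPolynomial σ K} (hv : v ∈ T.homPiece w a) :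
    bar K σ _ v ∈ T.barPiece a := by
  rw [barPiece, Finsupp.mem_supported]
  intro g hg
  have hg' : constantCoeff (v g) ≠ 0 :=
    (Finsupp.mem_support_iff (f := bar K σ _ v)).1 hg
  have := hv g hg'
  rw [map_zero, eq_comm, sub_eq_zero] at this
  exact this.symm

theorem unbar_mem_homPiece {a : A} {v : T.gens →₀ K} (hv : v ∈ T.barPiece a) :
    unbar K σ _ v ∈ T.homPiece w a := by
  rw [barPiece, Finsupp.mem_supported] at hv
  intro g
  rw [unbar_apply]
  by_cases h : v g = 0
  · rw [h, map_zero]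
    exact isWeightedHomogeneous_zero _ _ _
  · rw [← show T.deg g = a from hv (Finsupp.mem_support_iff.2 h), sub_self]
    exact isWeightedHomogeneous_C _ _

end Stage

variable {M : Type u} [AddCommGroup M] [Module (MvPolynomial σ K) M] {𝓜 : A → AddSubgroup M}

/-- `bar` is the reduction modulo all variables and `unbar` a section of it, so killing every
variable computes the homology of K ⊗ F. The next theorem is the reverse inequality. -/
theorem betti_le_resBetti (i : ℕ) (a : A) :
    betti K w 𝓜 i a ≤ resBetti (K := K) w 𝓜 Set.univ i a := by
  refine relRank_le_of_injective (unbar K σ (resolution K w 𝓜 i).gens) ?_ ?_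
  · intro z hz
    refine mem_cyclesMod.2 ?_
    cases i with
    | zero => exact ⟨Stage.unbar_mem_homPiece hz, trivial⟩
    | succ i =>
      refine ⟨Stage.unbar_mem_homPiece hz.1, mem_varSub_univ_iff_bar.2 ?_⟩
      refine ((resolution K w 𝓜 i).bar_diff w (unbar K σ _ z)).trans ?_
      exact (congrArg ((resolution K w 𝓜 i).diffBar w) (bar_unbar z)).trans hz.2
  · intro z _ hb
    obtain ⟨y, hy, hzy⟩ := mem_boundariesMod.1 hb
    have h1 := mem_varSub_univ_iff_bar.1 hzy
    rw [map_sub, bar_unbar, sub_eq_zero] at h1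
    exact ⟨bar K σ _ y, Stage.bar_mem_barPiece hy,
      ((resolution K w 𝓜 i).bar_diff w y).symm.trans h1.symm⟩

theorem resBetti_univ_le_betti (i : ℕ) (a : A) :
    resBetti (K := K) w 𝓜 Set.univ i a ≤ betti K w 𝓜 i a := by
  refine relRank_le_of_injective (bar K σ (resolution K w 𝓜 i).gens) ?_ ?_
  · intro z hz
    obtain ⟨hz, hc⟩ := mem_cyclesMod.1 hz
    cases i with
    | zero => exact Stage.bar_mem_barPiece hz
    | succ i => exact ⟨Stage.bar_mem_barPiece hz,
        ((resolution K w 𝓜 i).bar_diff w z).symm.trans (mem_varSub_univ_iff_bar.1 hc)⟩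
  · rintro z _ ⟨y, hy, hyz⟩
    refine mem_boundariesMod.2 ⟨unbar K σ _ y, Stage.unbar_mem_homPiece hy,
      mem_varSub_univ_iff_bar.2 ?_⟩
    rw [map_sub, sub_eq_zero, ← hyz]
    refine Eq.symm (((resolution K w 𝓜 i).bar_diff w (unbar K σ _ y)).trans ?_)
    rw [bar_unbar]

/-! ### Vanishing in negative degrees -/

theorem nonneg_of_isWeightedHomogeneous {ℓ : A →+ ℤ} (hw : ∀ s, 0 ≤ ℓ (w s))
    {p : MvPolynomial σ K} {a : A} (hp : IsWeightedHomogeneous w p a) (h0 : p ≠ 0) : 0 ≤ ℓ a := by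
  obtain ⟨m, hm⟩ := ne_zero_iff.1 h0
  rw [← hp hm, Finsupp.weight_apply, map_finsuppSum]
  exact Finset.sum_nonneg fun s _ => by
    change 0 ≤ ℓ (m s • w s)
    rw [map_nsmul]
    exact nsmul_nonneg (hw s) _

theorem Stage.nonneg_of_isHomogeneous {T : Stage K σ A} {ℓ : A →+ ℤ} (hw : ∀ s, 0 ≤ ℓ (w s))
    (hT : ∀ g, 0 ≤ ℓ (T.deg g)) {v : T.gens →₀ MvPolynomial σ K} {a : A}
    (hv : T.IsHomogeneous w v a) (h0 : v ≠ 0) : 0 ≤ ℓ a := by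
  obtain ⟨g, hg⟩ := Finsupp.ne_iff.1 h0
  have := nonneg_of_isWeightedHomogeneous hw (hv g) hg
  rw [map_sub, sub_nonneg] at this
  exact (hT g).trans this

theorem nonneg_deg_resolution {ℓ : A →+ ℤ} (hw : ∀ s, 0 ≤ ℓ (w s))
    (h𝓜 : ∀ a, ∀ m ∈ 𝓜 a, m ≠ 0 → 0 ≤ ℓ a) (i : ℕ) (g : (resolution K w 𝓜 i).gens) :
    0 ≤ ℓ ((resolution K w 𝓜 i).deg g) := by
  induction i with
  | zero => exact h𝓜 _ _ g.2.2 g.2.1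
  | succ i ih => exact Stage.nonneg_of_isHomogeneous hw ih g.2.2.2 g.2.1

/-- All generators of the resolution and all monomials have nonnegative `ℓ`-degree, so the free
modules themselves vanish there. -/
theorem resBetti_eq_zero {ℓ : A →+ ℤ} (hw : ∀ s, 0 ≤ ℓ (w s))
    (h𝓜 : ∀ a, ∀ m ∈ 𝓜 a, m ≠ 0 → 0 ≤ ℓ a) (J : Set σ) (i : ℕ) {a : A} (ha : ℓ a < 0) :
    resBetti (K := K) w 𝓜 J i a = 0 := by
  have : cyclesMod (fun i => (resolution K w 𝓜 i).homPiece w)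
      (fun i => ((resolution K w 𝓜 i).diff w).restrictScalars K)
      (fun i => varSub K J (resolution K w 𝓜 i).gens) i a = ⊥ := by
    rw [eq_bot_iff]
    intro v hv
    by_contra h0
    exact ha.not_ge (Stage.nonneg_of_isHomogeneous hw (nonneg_deg_resolution hw h𝓜 i)
      (mem_cyclesMod.1 hv).1 h0)
  refine (congrArg (relRank · _) this).trans ?_
  rw [relRank, Submodule.map_bot, rank_bot]

theorem resBetti_le_add (J : Set σ) {s : σ} (hs : s ∉ J) (i : ℕ) (a : A) :
    resBetti (K := K) w 𝓜 J i a ≤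
      resBetti (K := K) w 𝓜 J i (a - w s) + resBetti (K := K) w 𝓜 (insert s J) i a :=
  (regularStep_resolution 𝓜 J hs).bettiMod_le i a

/-! ### Adding variables of degree one -/

/-- Unrolled, `hs` bounds `h` by partial sums of `h'`; Pascal's rule for `multichoose` turns this
into one more variable. -/
theorem le_sum_multichoose_succ {h h' b : ℕ → Cardinal.{u}} {n : ℕ} (h0 : h 0 ≤ h' 0)
    (hs : ∀ d, h (d + 1) ≤ h d + h' (d + 1))
    (hb : ∀ d, h' d ≤ ∑ m ∈ Finset.range (d + 1), (n.multichoose (d - m) : Cardinal.{u}) * b m)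
    (d : ℕ) :
    h d ≤ ∑ m ∈ Finset.range (d + 1), ((n + 1).multichoose (d - m) : Cardinal.{u}) * b m := by
  induction d with
  | zero => simpa using h0.trans (hb 0)
  | succ d ih =>
    refine (hs d).trans ((add_le_add ih (hb (d + 1))).trans_eq ?_)
    rw [Finset.sum_range_succ _ (d + 1), Finset.sum_range_succ _ (d + 1), ← add_assoc,
      ← Finset.sum_add_distrib]
    congr 1
    · refine Finset.sum_congr rfl fun m hm => ?_
      rw [Nat.succ_sub (Finset.mem_range_succ_iff.1 hm), Nat.multichoose_succ_succ, Nat.cast_add,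
        add_mul, add_comm]
    · simp

/-- `U` is the set of variables still alive; the induction adds them back one at a time. -/
theorem resBetti_compl_le {ℓ : A →+ ℤ} (hw : ∀ s, 0 ≤ ℓ (w s))
    (h𝓜 : ∀ a, ∀ m ∈ 𝓜 a, m ≠ 0 → 0 ≤ ℓ a) {δ : A} (hδ : ℓ δ = 1) {a₀ : A} (ha₀ : ℓ a₀ = 0)
    (i : ℕ) (U : Finset σ) (hU : ∀ s ∈ U, w s = δ) (d : ℕ) :
    resBetti (K := K) w 𝓜 (U : Set σ)ᶜ i (a₀ + d • δ) ≤
      ∑ m ∈ Finset.range (d + 1), (U.card.multichoose (d - m) : Cardinal.{u}) *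
        betti K w 𝓜 i (a₀ + m • δ) := by
  classical
  induction U using Finset.induction_on generalizing d with
  | empty =>
    -- With every variable killed only `m = d` survives, as `multichoose 0 (c + 1) = 0`.
    rw [Finset.sum_range_succ, Finset.sum_eq_zero, zero_add]
    · simpa using resBetti_univ_le_betti i _
    · intro m hm
      obtain ⟨c, hc⟩ := Nat.exists_eq_add_of_lt (Finset.mem_range.1 hm)
      rw [show d - m = c + 1 by omega, Finset.card_empty, Nat.multichoose_zero_succ, Nat.cast_zero,
        zero_mul]
  | insert s U hs ih =>
    have hsU : insert s ((insert s U : Finset σ) : Set σ)ᶜ = (U : Set σ)ᶜ := by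
      ext t
      by_cases h : t = s
      · simp [h, hs]
      · simp [h]
    have hstep := fun a => resBetti_le_add (K := K) (w := w) (𝓜 := 𝓜)
      ((insert s U : Finset σ) : Set σ)ᶜ (s := s) (by simp) i a
    rw [hsU, hU s (Finset.mem_insert_self s U)] at hstep
    rw [Finset.card_insert_of_notMem hs]
    refine le_sum_multichoose_succ (h := fun d => resBetti (K := K) w 𝓜
      ((insert s U : Finset σ) : Set σ)ᶜ i (a₀ + d • δ)) (b := fun m => betti K w 𝓜 i (a₀ + m • δ))
      ?_ (fun d => ?_)
      (fun d => ih (fun t ht => hU t (Finset.mem_insert_of_mem ht)) d) d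
    -- For `d = 0` the shifted term lies in `ℓ`-degree -1 and vanishes.
    · refine (hstep _).trans_eq ?_
      rw [resBetti_eq_zero hw h𝓜 _ _ (by simp [hδ, ha₀]), zero_add]
    · refine (hstep _).trans_eq ?_
      rw [succ_nsmul, ← add_assoc, add_sub_cancel_right]

end Bar

/-! ### The strand of the Rees algebra in a given degree -/

section ReesStrand

variable {K : Type u} [Field K] {N k : ℕ} (f : Fin (k + 1) → MvPolynomial (Fin N) K)

/-- The inclusion of the Rees algebra in `R[t]`. -/
def Rees.val : Rees f →+* Polynomial (MvPolynomial (Fin N) K) :=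
  (reesAlgebra (Ideal.span (Set.range f))).val.toRingHom

theorem Rees.val_injective : Function.Injective (Rees.val f) := Subtype.val_injective

/-- The presentation of the Rees algebra, as a map to `R[t]`. -/
def presentationVal :
    MvPolynomial (Fin N ⊕ Fin (k + 1)) K →+* Polynomial (MvPolynomial (Fin N) K) :=
  (Rees.val f).comp (Rees.presentation f)

@[simp]
theorem presentationVal_C (c : K) : presentationVal f (C c) = Polynomial.C (C c) :=
  congrArg (Rees.val f) (eval₂Hom_C _ _ c)

@[simp]
theorem presentationVal_inl (s : Fin N) :
    presentationVal f (X (Sum.inl s)) = Polynomial.C (X s) :=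
  congrArg (Rees.val f) (eval₂Hom_X' _ _ (Sum.inl s))

@[simp]
theorem presentationVal_inr (l : Fin (k + 1)) :
    presentationVal f (X (Sum.inr l)) = Polynomial.monomial 1 (f l) :=
  congrArg (Rees.val f) (eval₂Hom_X' _ _ (Sum.inr l))

theorem presentationVal_rename (p : MvPolynomial (Fin N) K) :
    presentationVal f (rename Sum.inl p) = Polynomial.C p := by
  induction p using MvPolynomial.induction_on with
  | C c => simp
  | add p q hp hq => simp only [map_add, hp, hq]
  | mul_X p s hp => simp only [map_mul, hp, rename_X, presentationVal_inl]

/-- The Rees algebra is generated over R by `I t`, and `I` is spanned over R by the `f l`. -/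
theorem exists_presentationVal_eq {d : ℕ} {m : MvPolynomial (Fin N) K}
    (hm : m ∈ Ideal.span (Set.range f) ^ d) :
    ∃ q, presentationVal f q = Polynomial.monomial d m := by
  have h := reesAlgebra.monomial_mem.2 hm
  rw [← adjoin_monomial_eq_reesAlgebra] at h
  refine Algebra.adjoin_induction (p := fun x _ => ∃ q, presentationVal f q = x)
    ?_ ?_ ?_ ?_ h
  · rintro _ ⟨x, hx, rfl⟩
    refine Submodule.span_induction (p := fun x _ => ∃ q, presentationVal f q =
      Polynomial.monomial 1 x) ?_ ⟨0, by simp⟩ ?_ ?_ hx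
    · rintro _ ⟨l, rfl⟩
      exact ⟨X (Sum.inr l), presentationVal_inr f l⟩
    · rintro x y _ _ ⟨q, hq⟩ ⟨q', hq'⟩
      exact ⟨q + q', by simp [hq, hq']⟩
    · rintro p x _ ⟨q, hq⟩
      exact ⟨rename Sum.inl p * q, by
        rw [map_mul, presentationVal_rename, hq, Polynomial.C_mul_monomial, smul_eq_mul]⟩
  · exact fun p => ⟨rename Sum.inl p, presentationVal_rename f p⟩
  · rintro x y _ _ ⟨q, rfl⟩ ⟨q', rfl⟩
    exact ⟨q + q', map_add _ _ _⟩
  · rintro x y _ _ ⟨q, rfl⟩ ⟨q', rfl⟩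
    exact ⟨q * q', map_mul _ _ _⟩

/-! ### Bidegrees under the presentation, and the strand in w-degree d. -/

variable {f} {r : ℕ}

theorem isWeightedHomogeneous_int {p : MvPolynomial (Fin N) K} (hp : p.IsHomogeneous r) :
    IsWeightedHomogeneous (fun _ : Fin N => (1 : ℤ)) p r := by
  intro m hm
  rw [← hp hm, Finsupp.weight_apply, Finsupp.weight_apply]
  simp [Finsupp.sum]

/-- Each w-variable contributes a factor `f l` of degree `r` and one power of t, whence degree `j +
r * e`. -/
theorem presentationVal_monomial (hf : ∀ l, (f l).IsHomogeneous r)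
    (μ : Fin N ⊕ Fin (k + 1) →₀ ℕ) (c : K) :
    ∃ (j : ℤ) (e : ℕ) (y : MvPolynomial (Fin N) K),
      IsWeightedHomogeneous (bideg N k) (monomial μ c) (j, (e : ℤ)) ∧
      IsWeightedHomogeneous (fun _ => (1 : ℤ)) y (j + r * e) ∧
      presentationVal f (monomial μ c) = Polynomial.monomial e y := by
  refine MvPolynomial.induction_on_monomial (motive := fun p => ∃ (j : ℤ) (e : ℕ)
    (y : MvPolynomial (Fin N) K), IsWeightedHomogeneous (bideg N k) p (j, (e : ℤ)) ∧
      IsWeightedHomogeneous (fun _ => (1 : ℤ)) y (j + r * e) ∧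
      presentationVal f p = Polynomial.monomial e y) ?_ ?_ μ c
  · exact fun c => ⟨0, 0, C c, isWeightedHomogeneous_C _ _, by
      simpa using isWeightedHomogeneous_C _ _, by simp⟩
  · intro p s hp
    obtain ⟨j, e, y, h1, h2, h3⟩ := hp
    rcases s with s | l
    · refine ⟨j + 1, e, y * X s, ?_, ?_, ?_⟩
      · simpa [bideg] using h1.mul (isWeightedHomogeneous_X K (bideg N k) (Sum.inl s))
      · rw [add_right_comm]
        exact h2.mul (isWeightedHomogeneous_X K _ s)
      · rw [map_mul, h3, presentationVal_inl, Polynomial.monomial_mul_C]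
    · refine ⟨j, e + 1, y * f l, ?_, ?_, ?_⟩
      · simpa [bideg] using h1.mul (isWeightedHomogeneous_X K (bideg N k) (Sum.inr l))
      · have := h2.mul (isWeightedHomogeneous_int (hf l))
        rwa [add_assoc, ← mul_add_one, ← Nat.cast_add_one] at this
      · rw [map_mul, h3, presentationVal_inr, Polynomial.monomial_mul_monomial]

theorem presentationVal_of_isWeightedHomogeneous (hf : ∀ l, (f l).IsHomogeneous r) {j : ℤ} {d : ℕ}
    {q : MvPolynomial (Fin N ⊕ Fin (k + 1)) K}
    (hq : IsWeightedHomogeneous (bideg N k) q (j, (d : ℤ))) :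
    ∃ y, IsWeightedHomogeneous (fun _ => (1 : ℤ)) y (j + r * d) ∧
      presentationVal f q = Polynomial.monomial d y := by
  rw [q.as_sum, map_sum]
  refine Finset.sum_induction _ (fun x => ∃ y, IsWeightedHomogeneous (fun _ => (1 : ℤ)) y
    (j + r * d) ∧ x = Polynomial.monomial d y) ?_ ⟨0, isWeightedHomogeneous_zero _ _ _, by simp⟩ ?_
  · rintro _ _ ⟨y, hy, rfl⟩ ⟨y', hy', rfl⟩
    exact ⟨y + y', hy.add hy', (map_add _ _ _).symm⟩
  · intro μ hμ
    obtain ⟨j', e, y, h1, h2, h3⟩ := presentationVal_monomial hf μ (coeff μ q)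
    have hμ' := mem_support_iff.1 hμ
    have h4 : ((j', (e : ℤ)) : ℤ × ℤ) = (j, (d : ℤ)) :=
      (h1 (by rwa [coeff_monomial, if_pos rfl])).symm.trans (hq hμ')
    obtain ⟨rfl, h5⟩ := Prod.mk.inj h4
    obtain rfl := Nat.cast_injective h5
    exact ⟨y, h2, h3⟩

/-- The presentation respects degrees, so the bihomogeneous part of a preimage maps to the matching
part of the image. It makes preimages of homogeneous elements bihomogeneous. -/
theorem exists_presentationVal_eq_component (hf : ∀ l, (f l).IsHomogeneous r) (n : ℤ) (d : ℕ)
    (q : MvPolynomial (Fin N ⊕ Fin (k + 1)) K) :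
    ∃ q', IsWeightedHomogeneous (bideg N k) q' (n - r * d, (d : ℤ)) ∧
      presentationVal f q' = Polynomial.monomial d (weightedHomogeneousComponent
        (fun _ => (1 : ℤ)) n ((presentationVal f q).coeff d)) := by
  induction q using MvPolynomial.induction_on' with
  | monomial μ c =>
    obtain ⟨j, e, y, h1, h2, h3⟩ := presentationVal_monomial hf μ c
    rw [h3, Polynomial.coeff_monomial]
    by_cases he : e = d
    · subst he
      rw [if_pos rfl]
      by_cases hn : j + r * e = n
      · subst hn
        refine ⟨monomial μ c, by rwa [add_sub_cancel_right], ?_⟩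
        rw [h3, weightedHomogeneousComponent_eq_self h2]
      · exact ⟨0, isWeightedHomogeneous_zero _ _ _, by
          rw [h2.weightedHomogeneousComponent_ne n (Ne.symm hn), map_zero, map_zero]⟩
    · exact ⟨0, isWeightedHomogeneous_zero _ _ _, by simp [he]⟩
  | add p q hp hq =>
    obtain ⟨p', hp', hp⟩ := hp
    obtain ⟨q', hq', hq⟩ := hq
    exact ⟨p' + q', hp'.add hq', by
      rw [map_add, hp, hq, map_add, Polynomial.coeff_add, map_add, map_add]⟩

variable (f) in
/-- The identification of `I^d` with `I^d t^d`. -/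
def powToRees (d : ℕ) : ↥(Ideal.span (Set.range f) ^ d) →+ Rees f where
  toFun m := ⟨Polynomial.monomial d m.1, reesAlgebra.monomial_mem.2 m.2⟩
  map_zero' := Subtype.ext (map_zero (Polynomial.monomial d))
  map_add' m m' := Subtype.ext (map_add (Polynomial.monomial d) m.1 m'.1)

theorem val_powToRees {d : ℕ} (m : ↥(Ideal.span (Set.range f) ^ d)) :
    Rees.val f (powToRees f d m) = Polynomial.monomial d m.1 := rfl

theorem val_smul (q : MvPolynomial (Fin N ⊕ Fin (k + 1)) K) (x : Rees f) :
    Rees.val f (q • x) = presentationVal f q * Rees.val f x :=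
  map_mul (Rees.val f) (Rees.presentation f q) x

theorem strandEquiv_rees (hf : ∀ l, (f l).IsHomogeneous r) (d : ℕ) :
    StrandEquiv (K := K) (Sum.inl : Fin N → Fin N ⊕ Fin (k + 1)) (fun _ => (1 : ℤ)) (bideg N k)
      (AddMonoidHom.inl ℤ ℤ) (fun n => (n - r * d, (d : ℤ)))
      (idealPiece (Ideal.span (Set.range f) ^ d)) (reesPiece f) (powToRees f d) where
  injective_var := Sum.inl_injective
  weight _ := rfl
  shift a b := by
    ext <;> simp [add_sub_assoc]
  map_smul p m := by
    apply Rees.val_injective f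
    rw [val_smul, presentationVal_rename, val_powToRees, val_powToRees, Polynomial.C_mul_monomial]
    rfl
  injective m m' h :=
    Subtype.ext (Polynomial.monomial_injective d (congrArg (Rees.val f) h))
  map_mem n m hm := by
    obtain ⟨q, hq⟩ := exists_presentationVal_eq f m.2
    obtain ⟨q', hq', h⟩ := exists_presentationVal_eq_component hf n d q
    refine ⟨q', hq', Rees.val_injective f (h.trans ?_)⟩
    have hm' : m.1 ∈ weightedHomogeneousSubmodule K (fun _ : Fin N => (1 : ℤ)) n := hm
    rw [hq, Polynomial.coeff_monomial_same, weightedHomogeneousComponent_eq_self hm',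
      val_powToRees]
  smul_mem a b p hp m hm := by
    obtain ⟨q, hq, rfl⟩ := hm
    exact ⟨p * q, hp.mul hq, map_mul (Rees.presentation f) p q⟩
  exists_eq n x hx := by
    obtain ⟨q, hq, rfl⟩ := hx
    obtain ⟨y, hy, h⟩ := presentationVal_of_isWeightedHomogeneous hf hq
    rw [sub_add_cancel] at hy
    have hmem : presentationVal f q ∈ reesAlgebra (Ideal.span (Set.range f)) :=
      (Rees.presentation f q).2
    rw [h, reesAlgebra.monomial_mem] at hmem
    exact ⟨⟨y, hmem⟩, hy, Rees.val_injective f h.symm⟩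

theorem nonneg_of_mem_reesPiece (a : ℤ × ℤ) (x : Rees f) (hx : x ∈ reesPiece f a) (h0 : x ≠ 0) :
    0 ≤ AddMonoidHom.snd ℤ ℤ a := by
  obtain ⟨q, hq, rfl⟩ := hx
  refine nonneg_of_isWeightedHomogeneous (w := bideg N k) ?_ hq ?_
  · rintro (s | l) <;> simp [bideg]
  · rintro rfl
    exact h0 (map_zero (Rees.presentation f))

end ReesStrand

end GradedBetti

end

theorem theorem3p1 {K : Type u} [Field K] (N k r : ℕ)
    (f : Fin (k + 1) → MvPolynomial (Fin N) K) (hf : ∀ i, (f i).IsHomogeneous r)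
    (i d : ℕ) (j : ℤ) :
    GradedBetti.idealBetti (Ideal.span (Set.range f) ^ d) i (j + r * d) ≤
      ∑ m ∈ Finset.range (d + 1),
        ((d + k - m).choose (d - m) : Cardinal.{u}) * GradedBetti.reesBetti f i (j, m) := by
  -- `U` is the set of w-variables; its complement is the set of x-variables, already killed by the
  -- comparison.
  let U : Finset (Fin N ⊕ Fin (k + 1)) := Finset.univ.map Function.Embedding.inr
  have hU : Set.range (Sum.inl : Fin N → Fin N ⊕ Fin (k + 1)) = (U : Set _)ᶜ := by
    ext s
    cases s <;> simp [U]
  have hcard : U.card = k + 1 := by simp [U]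
  refine ((GradedBetti.betti_le_resBetti i _).trans
    ((GradedBetti.strandEquiv_rees hf d).resBetti_le i _)).trans ?_
  have h := GradedBetti.resBetti_compl_le (K := K) (w := GradedBetti.bideg N k)
    (𝓜 := GradedBetti.reesPiece f) (ℓ := AddMonoidHom.snd ℤ ℤ) (δ := (0, 1)) (a₀ := (j, 0))
    (by rintro (s | l) <;> simp [GradedBetti.bideg]) GradedBetti.nonneg_of_mem_reesPiece rfl rfl
    i U (by simp [U, GradedBetti.bideg]) d
  have hdeg : ∀ m : ℕ, ((j, 0) : ℤ × ℤ) + m • (0, 1) = (j, (m : ℤ)) := fun m => by simp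
  simp only [hdeg] at h
  rw [hU, add_sub_cancel_right]
  refine h.trans_eq (Finset.sum_congr rfl fun m hm => ?_)
  have := Finset.mem_range_succ_iff.1 hm
  rw [hcard, Nat.multichoose_eq, show k + 1 + (d - m) - 1 = d + k - m by omega]
  rfl
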